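/- Let $\Bbbk$ be a field and let $H$ be a very well-covered graph (no isolated vertices, and every minimal vertex cover contains exactly half of the vertices) which is Cohen--Macaulay over $\Bbbk$ (that is, $\Bbbk[V(H)]/I(H)$ is a Cohen--Macaulay ring, where $I(H)$ is the edge ideal), with vertex set $V(H)=\{x_1,\dots,x_{d_0}\}\cup\{y_1,\dots,y_{d_0}\}$ labelled so that $\{x_1,\dots,x_{d_0}\}$ is a minimal vertex cover, $\{y_1,\dots,y_{d_0}\}$ is a maximal independent set, $x_iy_i\in E(H)$ for all $i$, and $x_iy_j\in E(H)$ implies $i\le j$. Let $n_1,\dots,n_{d_0}$ be positive integers and let $G\cong H(n_1,\dots,n_{d_0})$, the graph on the vertices $x_{ij},y_{ij}$ ($1\le i\le d_0$, $1\le j\le n_i$) obtained from $H$ by replacing each edge $x_iy_i$ by the complete bipartite graph $K_{n_i,n_i}$ between $\{x_{i1},\dots,x_{in_i}\}$ and $\{y_{i1},\dots,y_{in_i}\}$, all copies of a vertex inheriting its other adjacencies. In $S=\Bbbk[V(G)]$ put $x'_i=x_{i1}\cdots x_{in_i}$ and $y'_i=y_{i1}\cdots y_{in_i}$, and let $J(G)\subseteq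 S$ be the cover ideal, generated by the monomials $\prod_{v\in C}v$ with $C$ a vertex cover of $G$. For a minimal vertex cover $C$ of $H$ put $\mathbf z_C=\prod_{x_i\in C}x'_i\prod_{y_i\in C}y'_i$ and $$\mathcal C(H;C)=\{x_s : y_s\in C \text{ and } (C\setminus\{y_s\})\cup\{x_s\} \text{ is a minimal vertex cover of } H\}.$$ For $i\ge 0$ let $F_i$ be the free $S$-module with basis the symbols $\mathbf f(C;\sigma)$, where $C$ is a minimal vertex cover of $H$ and $\sigma\subseteq\mathcal C(H;C)$ with $|\sigma|=i$. Define $d_0:F_0\to J(G)$ by $d_0(\mathbf f(C;\emptyset))=\mathbf z_C$, and, for $i>0$, $d_i:F_i\to F_{i-1}$ by $$d_i(\mathbf f(C;\sigma))=\sum_{x_s\in\sigma}(-1)^{\alpha(\sigma;x_s)}\bigl[y'_s\,\mathbf f((C\setminus\{y_s\})\cup\{x_s\};\sigma\setminus\{x_s\})-x'_s\,\mathbf f(C;\sigma\setminus\{x_s\})\bigr],$$ where $\alpha(\sigma;x_s)=|\{x_j\in\sigma : j>s\}|$. Then $$\cdots\to F_i\xrightarrow{d_i}F_{i-1}\to\cdots\to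 F_1\xrightarrow{d_1}F_0\xrightarrow{d_0}J(G)\to 0$$ is a minimal free resolution of $J(G)$ over $S$: it is an exact complex of finitely generated free modules and $d_i(F_i)\subseteq\mathfrak m F_{i-1}$ for all $i\ge1$, where $\mathfrak m$ is the ideal generated by the variables. Moreover, all maps are homogeneous of degree $0$ when $\mathbf f(C;\sigma)$ is given the degree of the monomial $\mathbf z_C\prod_{x_s\in\sigma}x'_s$, with respect to each of the following gradings of $S$: the fine $\mathbb Z^{V(G)}$-grading; the $\mathbb Z^{n_1+\cdots+n_{d_0}}$-grading in which $x_{ij}$ and $y_{ij}$ both have as degree the unit vector at position $(i,j)$, so that $x'_i$ and $y'_i$ both have as degree the indicator vector of the $i$-th block of $n_i$ positions; and the standard $\mathbb Z$-grading, in which $x'_i$ and $y'_i$ have degree $n_i$. -/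

import Mathlib

open MvPolynomial

namespace CoverResolution

noncomputable section

/-! ### Graphs, vertex covers, edge and cover ideals -/

/-- `C` is a minimal vertex cover of `G` (minimal with respect to inclusion). -/
def IsMinVertexCover {W : Type*} (G : SimpleGraph W) (C : Finset W) : Prop :=
  Minimal (fun D : Finset W => G.IsVertexCover (D : Set W)) C

/-- `A` is a maximal independent set of `G` (maximal with respect to inclusion). -/
def IsMaxIndepSet {W : Type*} (G : SimpleGraph W) (A : Finset W) : Prop :=
  Maximal (fun B : Finset W => G.IsIndepSet (B : Set W)) A

/-- A graph is very well-covered if it has no isolated vertices and every minimal vertex cover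
contains exactly half of the vertices. -/
structure IsVeryWellCovered {W : Type*} [Fintype W] (G : SimpleGraph W) : Prop where
  no_isolated : ∀ v, ∃ w, G.Adj v w
  card_cover : ∀ C : Finset W, IsMinVertexCover G C → 2 * C.card = Fintype.card W

/-- The edge ideal `I(G)` in the polynomial ring on the vertices of `G`. -/
def edgeIdeal (k : Type*) [Field k] {W : Type*} (G : SimpleGraph W) : Ideal (MvPolynomial W k) :=
  Ideal.span {f | ∃ v w, G.Adj v w ∧ f = X v * X w}

/-- The cover ideal `J(G)` in the polynomial ring on the vertices of `G`. -/
def coverIdeal (k : Type*) [Field k] {W : Type*} (G : SimpleGraph W) : Ideal (MvPolynomial W k) :=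
  Ideal.span {f | ∃ C : Finset W, G.IsVertexCover (C : Set W) ∧ f = ∏ v ∈ C, X v}

/-- A Noetherian ring is Cohen–Macaulay if each of its localizations `A` at a maximal ideal has
depth equal to its dimension, that is, admits an `A`-regular sequence whose length is the Krull
dimension of `A`. -/
structure IsCohenMacaulayRing (R : Type*) [CommRing R] : Prop where
  noetherian : IsNoetherianRing R
  depth_eq_dim : ∀ (m : Ideal R) [m.IsMaximal], ∃ rs : List (Localization.AtPrime m),
    RingTheory.Sequence.IsRegular (Localization.AtPrime m) rs ∧
      (rs.length : WithBot ℕ∞) = ringKrullDim (Localization.AtPrime m)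

/-- `G` is Cohen–Macaulay over `k` if `k[V(G)] / I(G)` is a Cohen–Macaulay ring. -/
def IsCohenMacaulayGraph (k : Type*) [Field k] {W : Type*} (G : SimpleGraph W) : Prop :=
  IsCohenMacaulayRing (MvPolynomial W k ⧸ edgeIdeal k G)

/-! ### Labelled very well-covered graphs

The vertex set is `Fin d ⊕ Fin d`; `Sum.inl i` is `x_i` and `Sum.inr i` is `y_i`. -/

/-- The labelling condition `(∗)`: the `x_i` form a minimal vertex cover, the `y_i` form a maximal
independent set, every `x_i y_i` is an edge, and `x_i y_j` can be an edge only for `i ≤ j`. -/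
structure IsStandardLabelled {d : ℕ} (H : SimpleGraph (Fin d ⊕ Fin d)) : Prop where
  x_cover : IsMinVertexCover H (Finset.univ.map Function.Embedding.inl)
  y_indep : IsMaxIndepSet H (Finset.univ.map Function.Embedding.inr)
  matching : ∀ i, H.Adj (Sum.inl i) (Sum.inr i)
  le_of_adj : ∀ i j, H.Adj (Sum.inl i) (Sum.inr j) → i ≤ j

/-- The index `i` of the vertex `x_i` or `y_i`. -/
def idx {d : ℕ} : Fin d ⊕ Fin d → Fin d := Sum.elim id id

/-- The vertices of `H(n_1, …, n_d)`: `⟨Sum.inl i, j⟩` is `x_{ij}` and `⟨Sum.inr i, j⟩` is `y_{ij}`,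
with `j` running over `n_i` values. -/
abbrev BlowUpVertex {d : ℕ} (n : Fin d → ℕ) : Type := Σ v : Fin d ⊕ Fin d, Fin (n (idx v))

/-- The graph `H(n_1, …, n_d)`, obtained from `H` by replacing each edge `x_i y_i` by the complete
bipartite graph `K_{n_i, n_i}`: copies of `u` and `v` are adjacent exactly when `u` and `v` are. -/
def blowUp {d : ℕ} (H : SimpleGraph (Fin d ⊕ Fin d)) (n : Fin d → ℕ) :
    SimpleGraph (BlowUpVertex n) :=
  H.comap Sigma.fst

/-- When all `x_i y_i` are edges, `blowUp H n` is literally the edge replacement: inside the `i`-th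
block there is a complete bipartite graph between the `x_{ij}` and the `y_{ij}`, and vertices of
different blocks inherit their adjacency from `H`. -/
theorem blowUp_adj_iff {d : ℕ} {H : SimpleGraph (Fin d ⊕ Fin d)}
    (h : ∀ i, H.Adj (Sum.inl i) (Sum.inr i)) (n : Fin d → ℕ) (p q : BlowUpVertex n) :
    (blowUp H n).Adj p q ↔
      (idx p.1 = idx q.1 ∧ p.1 ≠ q.1) ∨ (idx p.1 ≠ idx q.1 ∧ H.Adj p.1 q.1) := by
  obtain ⟨u, a⟩ := p
  obtain ⟨v, b⟩ := q
  have key : idx u = idx v → (H.Adj u v ↔ u ≠ v) := by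
    rcases u with u | u <;> rcases v with v | v <;> simp only [idx, Sum.elim_inl, Sum.elim_inr,
      id] <;> rintro rfl <;> simp [h, (h _).symm]
  by_cases huv : idx u = idx v
  · simp [blowUp, huv, key huv]
  · simp [blowUp, huv]

/-! ### The symbols `f(C; σ)` -/

open Classical in
/-- The set `𝒞(H; C)`, given by indices: `x_s` belongs to it if `y_s ∈ C` and
`(C \ {y_s}) ∪ {x_s}` is again a minimal vertex cover of `H`. -/
def swapSet {d : ℕ} (H : SimpleGraph (Fin d ⊕ Fin d)) (C : Finset (Fin d ⊕ Fin d)) :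
    Finset (Fin d) :=
  Finset.univ.filter fun s => Sum.inr s ∈ C ∧
    IsMinVertexCover H (insert (Sum.inl s) (C.erase (Sum.inr s)))

/-- The symbols `f(C; σ)` with `C` a minimal vertex cover of `H` and `σ ⊆ 𝒞(H; C)`, `|σ| = i`.
The element `s` of `σ` stands for `x_s`. -/
@[ext]
structure Symb {d : ℕ} (H : SimpleGraph (Fin d ⊕ Fin d)) (i : ℕ) where
  C : Finset (Fin d ⊕ Fin d)
  σ : Finset (Fin d)
  isMin : IsMinVertexCover H C
  subset : σ ⊆ swapSet H C
  card_eq : σ.card = i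

/-- `f(C; σ \ {x_s})`. -/
def Symb.drop {d : ℕ} {H : SimpleGraph (Fin d ⊕ Fin d)} {i : ℕ} (p : Symb H (i + 1)) (s : Fin d)
    (hs : s ∈ p.σ) : Symb H i where
  C := p.C
  σ := p.σ.erase s
  isMin := p.isMin
  subset := (Finset.erase_subset _ _).trans p.subset
  card_eq := by rw [Finset.card_erase_of_mem hs, p.card_eq, Nat.add_sub_cancel]

theorem mem_swapSet {d : ℕ} {H : SimpleGraph (Fin d ⊕ Fin d)} {C : Finset (Fin d ⊕ Fin d)}
    {s : Fin d} : s ∈ swapSet H C ↔ Sum.inr s ∈ C ∧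
      IsMinVertexCover H (insert (Sum.inl s) (C.erase (Sum.inr s))) := by
  simp [swapSet]

/-- In a very well-covered graph a vertex cover with at most half of the vertices is minimal. -/
theorem isMinVertexCover_of_card_le {W : Type*} [Fintype W] {G : SimpleGraph W}
    (hG : IsVeryWellCovered G) {C : Finset W} (hC : G.IsVertexCover (C : Set W))
    (hcard : 2 * C.card ≤ Fintype.card W) : IsMinVertexCover G C := by
  obtain ⟨D, hDC, hD⟩ := exists_minimal_le_of_wellFoundedLT
    (fun D : Finset W => G.IsVertexCover (D : Set W)) C hC
  have h1 := hG.card_cover D hD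
  have : D = C := Finset.eq_of_subset_of_card_le hDC (by omega)
  exact this ▸ hD

/-- The exchanges indexed by two different elements of `𝒞(H; C)` can be carried out together. -/
theorem swapSet_swap {d : ℕ} {H : SimpleGraph (Fin d ⊕ Fin d)} (hH : IsVeryWellCovered H)
    (hl : IsStandardLabelled H) {C : Finset (Fin d ⊕ Fin d)} {s t : Fin d}
    (hs : s ∈ swapSet H C) (ht : t ∈ swapSet H C) (hst : t ≠ s) :
    t ∈ swapSet H (insert (Sum.inl s) (C.erase (Sum.inr s))) := by
  rw [mem_swapSet] at hs ht ⊢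
  have hmem : (Sum.inr t : Fin d ⊕ Fin d) ∈ insert (Sum.inl s) (C.erase (Sum.inr s)) := by
    simp [ht.1, hst]
  refine ⟨hmem, isMinVertexCover_of_card_le hH ?_ ?_⟩
  · intro u v huv
    have h1 := hs.2.prop huv
    have h2 := ht.2.prop huv
    have hind : ∀ a b : Fin d, ¬ H.Adj (Sum.inr a) (Sum.inr b) := by
      intro a b hab
      exact hl.y_indep.prop (by simp) (by simp) hab.ne hab
    simp only [Finset.coe_insert, Finset.coe_erase, Set.mem_insert_iff, Set.mem_sdiff,
      Finset.mem_coe, Set.mem_singleton_iff] at h1 h2 ⊢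
    by_contra hcon
    have h3 : (u = Sum.inr t ∧ v = Sum.inr s) ∨ (u = Sum.inr s ∧ v = Sum.inr t) := by
      have : (Sum.inr s : Fin d ⊕ Fin d) ≠ Sum.inr t := by simpa using hst.symm
      grind
    rcases h3 with ⟨rfl, rfl⟩ | ⟨rfl, rfl⟩
    · exact hind _ _ huv
    · exact hind _ _ huv
  · have h1 := hH.card_cover _ hs.2
    have h2 := Finset.card_insert_le (Sum.inl t : Fin d ⊕ Fin d)
      ((insert (Sum.inl s) (C.erase (Sum.inr s))).erase (Sum.inr t))
    have h3 := Finset.card_erase_add_one hmem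
    omega

/-- `f((C \ {y_s}) ∪ {x_s}; σ \ {x_s})`. -/
def Symb.swap {d : ℕ} {H : SimpleGraph (Fin d ⊕ Fin d)} (hH : IsVeryWellCovered H)
    (hl : IsStandardLabelled H) {i : ℕ} (p : Symb H (i + 1)) (s : Fin d) (hs : s ∈ p.σ) :
    Symb H i where
  C := insert (Sum.inl s) (p.C.erase (Sum.inr s))
  σ := p.σ.erase s
  isMin := (mem_swapSet.1 (p.subset hs)).2
  subset := fun _ ht => swapSet_swap hH hl (p.subset hs) (p.subset (Finset.mem_of_mem_erase ht))
    (Finset.ne_of_mem_erase ht)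
  card_eq := by rw [Finset.card_erase_of_mem hs, p.card_eq, Nat.add_sub_cancel]

/-- `α(σ; x_s) = |{x_j ∈ σ : j > s}|`. -/
def alpha {d : ℕ} (σ : Finset (Fin d)) (s : Fin d) : ℕ := (σ.filter fun j => s < j).card

/-! ### The complex

`e` identifies the vertex set of `G` with that of `H(n_1, …, n_d)`; the complex lives over the
polynomial ring `k[V(G)]`. -/

/-- The products `x'_i = x_{i1} ⋯ x_{i n_i}` and `y'_i = y_{i1} ⋯ y_{i n_i}` in `k[V(G)]`. -/
def primed (k : Type*) [Field k] {d : ℕ} {n : Fin d → ℕ} {V : Type*} (e : BlowUpVertex n ≃ V)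
    (v : Fin d ⊕ Fin d) : MvPolynomial V k :=
  ∏ j : Fin (n (idx v)), X (e ⟨v, j⟩)

/-- The augmentation `d_0 : F_0 → k[V(G)]`, `f(C; ∅) ↦ z_C = ∏_{v ∈ C} v'`. -/
def augmentation (k : Type*) [Field k] {d : ℕ} (H : SimpleGraph (Fin d ⊕ Fin d))
    {n : Fin d → ℕ} {V : Type*} (e : BlowUpVertex n ≃ V) :
    (Symb H 0 →₀ MvPolynomial V k) →ₗ[MvPolynomial V k] MvPolynomial V k :=
  Finsupp.linearCombination (MvPolynomial V k) fun p => ∏ v ∈ p.C, primed k e v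

/-- The differential `F_{i+1} → F_i`,
`f(C; σ) ↦ ∑_{s ∈ σ} (-1)^α(σ; s) [y'_s f((C \ {y_s}) ∪ {x_s}; σ \ {x_s}) - x'_s f(C; σ \ {x_s})]`. -/
def differential (k : Type*) [Field k] {d : ℕ} {H : SimpleGraph (Fin d ⊕ Fin d)}
    (hH : IsVeryWellCovered H) (hl : IsStandardLabelled H) {n : Fin d → ℕ} {V : Type*}
    (e : BlowUpVertex n ≃ V) (i : ℕ) :
    (Symb H (i + 1) →₀ MvPolynomial V k) →ₗ[MvPolynomial V k] (Symb H i →₀ MvPolynomial V k) :=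
  Finsupp.linearCombination (MvPolynomial V k) fun p =>
    ∑ s ∈ p.σ.attach, (-1 : MvPolynomial V k) ^ alpha p.σ s.1 •
      (Finsupp.single (p.swap hH hl s.1 s.2) (primed k e (Sum.inr s.1)) -
        Finsupp.single (p.drop s.1 s.2) (primed k e (Sum.inl s.1)))

/-! ### Minimal multigraded free resolutions of ideals -/

/-- The complex of finitely generated free modules `⋯ → F_1 → F_0 → J → 0` over `k[V]`, where `F_i`
has basis `B i`, is a minimal free resolution of the ideal `J`: it is exact, and the image of
each `F_{i+1} → F_i` lies in `𝔪 F_i`, where `𝔪` is generated by the variables. -/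
structure IsMinimalFreeResolution {k : Type*} [Field k] {V : Type*} (J : Ideal (MvPolynomial V k))
    (B : ℕ → Type*)
    (δ : ∀ i, (B (i + 1) →₀ MvPolynomial V k) →ₗ[MvPolynomial V k] (B i →₀ MvPolynomial V k))
    (ε : (B 0 →₀ MvPolynomial V k) →ₗ[MvPolynomial V k] MvPolynomial V k) : Prop where
  finite : ∀ i, Finite (B i)
  range_augmentation : LinearMap.range ε = J
  exact_zero : Function.Exact (δ 0) ε
  exact_succ : ∀ i, Function.Exact (δ (i + 1)) (δ i)
  minimal : ∀ i, LinearMap.range (δ i) ≤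
    Ideal.span (Set.range (X : V → MvPolynomial V k)) •
      (⊤ : Submodule (MvPolynomial V k) (B i →₀ MvPolynomial V k))

/-- The maps of the complex are homogeneous of degree `0` for the `M`-grading in which the variable
`v` has degree `w v` and the basis element `b` of `F_i` has degree `deg i b`. -/
structure IsHomogeneousComplex {k : Type*} [Field k] {V : Type*} {M : Type*} [AddCommGroup M]
    (w : V → M) (B : ℕ → Type*) (deg : ∀ i, B i → M)
    (δ : ∀ i, (B (i + 1) →₀ MvPolynomial V k) →ₗ[MvPolynomial V k] (B i →₀ MvPolynomial V k))
    (ε : (B 0 →₀ MvPolynomial V k) →ₗ[MvPolynomial V k] MvPolynomial V k) : Prop where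
  augmentation : ∀ b, IsWeightedHomogeneous w (ε (Finsupp.single b 1)) (deg 0 b)
  differential : ∀ i b c,
    IsWeightedHomogeneous w (δ i (Finsupp.single b 1) c) (deg (i + 1) b - deg i c)

/-- The degree of `z_C x'_σ`, where `D v` is the degree of `v'` (that is, of `x'_i` or `y'_i`). -/
def symbDegree {M : Type*} [AddCommGroup M] {d : ℕ} {H : SimpleGraph (Fin d ⊕ Fin d)}
    (D : Fin d ⊕ Fin d → M) (i : ℕ) (p : Symb H i) : M :=
  ∑ v ∈ p.C, D v + ∑ s ∈ p.σ, D (Sum.inl s)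

/-- The fine grading by exponent vectors: a variable `v` of `k[V]` has degree the unit vector. -/
def fineDegree {V : Type*} [DecidableEq V] (v : V) : V → ℤ := Pi.single v 1

/-- The degree of `x'_i` or `y'_i` in the fine grading: its exponent vector. -/
def fineDegreePrimed {d : ℕ} {n : Fin d → ℕ} {V : Type*} [DecidableEq V] (e : BlowUpVertex n ≃ V)
    (v : Fin d ⊕ Fin d) : V → ℤ :=
  ∑ j : Fin (n (idx v)), Pi.single (e ⟨v, j⟩) 1

/-- The block grading with values in `ℤ^{n_1 + ⋯ + n_d}`: both `x_{ij}` and `y_{ij}` have degree the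
unit vector at position `(i, j)`. -/
def blockDegree {d : ℕ} {n : Fin d → ℕ} {V : Type*} (e : BlowUpVertex n ≃ V) (u : V) :
    (Σ i : Fin d, Fin (n i)) → ℤ :=
  Pi.single ⟨idx (e.symm u).1, (e.symm u).2⟩ 1

/-- In the block grading, `x'_i` and `y'_i` have degree `(0, …, 0, 1, …, 1, 0, …, 0)`, with `1`
exactly at the `n_i` positions of the `i`-th block. -/
def blockDegreePrimed {d : ℕ} (n : Fin d → ℕ) (v : Fin d ⊕ Fin d) :
    (Σ i : Fin d, Fin (n i)) → ℤ :=
  fun q => if q.1 = idx v then 1 else 0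

/-- In the standard grading of `k[V]`, `x'_i` and `y'_i` have degree `n_i`. -/
def totalDegreePrimed {d : ℕ} (n : Fin d → ℕ) (v : Fin d ⊕ Fin d) : ℤ := n (idx v)

end

end CoverResolution

/-! A minimal vertex cover of `H` contains exactly one of `x_i`, `y_i` for each `i`, so it is
recorded by the set `T` of its `y`-indices. A set `T` occurs exactly when it is closed under passing
from `i` to `j` along edges `x_i y_j` and contains no edge `x_i x_j`
(`isMinVertexCover_coverOf_iff`). The symbol `f(C; σ)` thereby becomes a cube with vertices `T \ ρ`,
`ρ ⊆ σ`, all of them covers, and the differential becomes the cubical boundary with weights `y'_s`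
and `x'_s`, which squares to zero (`cubeDiff_cubeDiff`).

Exactness is checked in each fine degree `a`. Let `A` and `B` be the sets of `i` for which `y'_i`,
respectively `x'_i`, divides the monomial of degree `a`. The part of degree `a` is spanned by the
cubes with `T ⊆ A` and `Bᶜ ⊆ T \ σ`, and there all weights may be replaced by 1. The admissible `T ⊇
Bᶜ` are closed under intersection, so if there are any, there is a least one, `T₀`. Deleting the
elements of `T \ T₀` from `T` in increasing order never leaves the admissible sets, thanks to the
order of the labelling (`isMinVertexCover_erase_of_isLeast`). The prisms swept out by these
deletions form a homotopy contracting the cubical complex to the point `T₀`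
(`cubeDiff_cubeHomotopy_add`).

Together these homotopies give a `k`-linear contraction of the augmented complex
(`cellDiff_cellHomotopy_add_symbChain`), from which exactness follows (`exists_differential_eq`).
The image of the augmentation is found by shrinking a cover of the blow-up to one induced from `H`
(`exists_isMinVertexCover_of_blowUp`); minimality and homogeneity are visible in the weights. -/

namespace CoverResolution

noncomputable section

/-! ### The cubical complex on pairs of finite sets -/

/-- A pair `(T, σ)` stands for the cube spanned by the sets `T \ ρ` with `ρ ⊆ σ`. -/
abbrev Cell (d : ℕ) : Type := Finset (Fin d) × Finset (Fin d)

/-- The cubical differential with weights `y` and `x` on the two faces in each direction. -/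
def cubeDiff {R : Type*} [CommRing R] {d : ℕ} (y x : Fin d → R) :
    (Cell d →₀ R) →ₗ[R] (Cell d →₀ R) :=
  Finsupp.linearCombination R fun p => ∑ s ∈ p.2, (-1 : R) ^ alpha p.2 s •
    (Finsupp.single (p.1.erase s, p.2.erase s) (y s) - Finsupp.single (p.1, p.2.erase s) (x s))

theorem cubeDiff_single {R : Type*} [CommRing R] {d : ℕ} (y x : Fin d → R)
    (T σ : Finset (Fin d)) (r : R) :
    cubeDiff y x (Finsupp.single (T, σ) r) = r • ∑ s ∈ σ, (-1 : R) ^ alpha σ s •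
      (Finsupp.single (T.erase s, σ.erase s) (y s) - Finsupp.single (T, σ.erase s) (x s)) := by
  simp [cubeDiff]

theorem alpha_erase_of_lt {d : ℕ} {σ : Finset (Fin d)} {s t : Fin d} (hst : s < t) :
    alpha (σ.erase s) t = alpha σ t := by
  unfold alpha
  congr 1
  ext j
  simp only [Finset.mem_filter, Finset.mem_erase]
  grind

theorem alpha_erase_of_gt {d : ℕ} {σ : Finset (Fin d)} {s t : Fin d} (hs : s ∈ σ) (hts : t < s) :
    alpha (σ.erase s) t + 1 = alpha σ t := by
  unfold alpha
  rw [Finset.filter_erase, Finset.card_erase_add_one (by simp [hs, hts])]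

/-- Deleting the smaller index leaves `alpha` of the larger unchanged, while deleting the larger
lowers `alpha` of the smaller by one. The two orders of deletion thus differ by one sign. -/
theorem neg_one_pow_alpha_antisymm {R : Type*} [CommRing R] {d : ℕ} {σ : Finset (Fin d)}
    {s t : Fin d} (hs : s ∈ σ) (ht : t ∈ σ) (hst : s ≠ t) :
    (-1 : R) ^ alpha σ s * (-1) ^ alpha (σ.erase s) t =
      -((-1 : R) ^ alpha σ t * (-1) ^ alpha (σ.erase t) s) := by
  rcases lt_or_gt_of_ne hst with h | h
  · rw [alpha_erase_of_lt h, ← alpha_erase_of_gt ht h]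
    ring
  · rw [alpha_erase_of_lt h, ← alpha_erase_of_gt hs h]
    ring

theorem cubeDiff_cubeDiff {R : Type*} [CommRing R] {d : ℕ} (y x : Fin d → R)
    (z : Cell d →₀ R) : cubeDiff y x (cubeDiff y x z) = 0 := by
  suffices h : cubeDiff y x ∘ₗ cubeDiff y x = 0 from LinearMap.congr_fun h z
  refine Finsupp.lhom_ext' fun p => LinearMap.ext_ring ?_
  obtain ⟨T, σ⟩ := p
  simp only [LinearMap.comp_apply, Finsupp.lsingle_apply, LinearMap.zero_apply]
  rw [cubeDiff_single, one_smul, map_sum]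
  have key : ∀ s ∈ σ, cubeDiff y x ((-1 : R) ^ alpha σ s •
      (Finsupp.single (T.erase s, σ.erase s) (y s) - Finsupp.single (T, σ.erase s) (x s))) =
      ∑ t ∈ σ.erase s, ((-1 : R) ^ alpha σ s * (-1) ^ alpha (σ.erase s) t) •
        (Finsupp.single ((T.erase s).erase t, (σ.erase s).erase t) (y s * y t) -
          Finsupp.single (T.erase s, (σ.erase s).erase t) (y s * x t) -
          Finsupp.single (T.erase t, (σ.erase s).erase t) (x s * y t) +
          Finsupp.single (T, (σ.erase s).erase t) (x s * x t)) := by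
    intro s _
    rw [map_smul, map_sub, cubeDiff_single, cubeDiff_single, Finset.smul_sum, Finset.smul_sum,
      ← Finset.sum_sub_distrib, Finset.smul_sum]
    refine Finset.sum_congr rfl fun t _ => ?_
    rw [mul_smul]
    congr 1
    rw [smul_comm (y s), smul_comm (x s), ← smul_sub]
    congr 1
    simp only [smul_sub, Finsupp.smul_single, smul_eq_mul]
    abel
  rw [Finset.sum_congr rfl key, Finset.sum_sigma']
  -- The sum runs over ordered pairs of distinct directions. Exchanging the pair preserves the
  -- codimension-two faces and reverses the sign.
  refine Finset.sum_involution (fun q _ => ⟨q.2, q.1⟩) ?_ ?_ ?_ ?_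
  · rintro ⟨s, t⟩ hst
    simp only [Finset.mem_sigma, Finset.mem_erase] at hst
    simp only
    rw [neg_one_pow_alpha_antisymm hst.1 hst.2.2 (Ne.symm hst.2.1), neg_smul,
      Finset.erase_right_comm (s := T) (a := t) (b := s),
      Finset.erase_right_comm (s := σ) (a := t) (b := s), mul_comm (y t) (y s),
      mul_comm (x t) (x s), mul_comm (y t) (x s), mul_comm (x t) (y s), neg_add_eq_zero]
    congr 1
    abel
  · rintro ⟨s, t⟩ hst _ h
    simp only [Finset.mem_sigma, Finset.mem_erase] at hst
    simp only [Sigma.mk.injEq, heq_eq_eq] at h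
    exact hst.2.1 h.1
  · rintro ⟨s, t⟩ hst
    simp only [Finset.mem_sigma, Finset.mem_erase] at hst ⊢
    exact ⟨hst.2.2, hst.2.1.symm, hst.1⟩
  · rintro ⟨s, t⟩ _
    rfl

/-! ### Contraction of the cubical complex -/

/-- The chain contracting the cube `(T, σ)` towards `T₀`, by removing from `T` its elements outside
`T₀` in increasing order. -/
def contract (R : Type*) [CommRing R] {d : ℕ} (T₀ T σ : Finset (Fin d)) : Cell d →₀ R :=
  if h : (T \ T₀).Nonempty then
    if (T \ T₀).min' h ∈ σ then 0
    else -(-1 : R) ^ σ.card • Finsupp.single (T, insert ((T \ T₀).min' h) σ) 1 +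
      contract R T₀ (T.erase ((T \ T₀).min' h)) σ
  else 0
termination_by T.card
decreasing_by
  exact Finset.card_erase_lt_of_mem (Finset.mem_sdiff.1 (Finset.min'_mem _ h)).1

theorem contract_of_subset (R : Type*) [CommRing R] {d : ℕ} {T₀ T : Finset (Fin d)}
    (σ : Finset (Fin d)) (h : T ⊆ T₀) : contract R T₀ T σ = 0 := by
  rw [contract, dif_neg]
  simp [Finset.sdiff_eq_empty_iff_subset.2 h]

theorem contract_of_mem (R : Type*) [CommRing R] {d : ℕ} {T₀ T σ : Finset (Fin d)} {s : Fin d}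
    (hs : IsLeast (T \ T₀ : Finset (Fin d)) s) (hσ : s ∈ σ) : contract R T₀ T σ = 0 := by
  have hmin : (T \ T₀).min' ⟨s, hs.1⟩ = s := (Finset.isLeast_min' _ _).unique hs
  rw [contract, dif_pos ⟨s, hs.1⟩, hmin, if_pos hσ]

theorem contract_of_notMem (R : Type*) [CommRing R] {d : ℕ} {T₀ T σ : Finset (Fin d)} {s : Fin d}
    (hs : IsLeast (T \ T₀ : Finset (Fin d)) s) (hσ : s ∉ σ) : contract R T₀ T σ =
      -(-1 : R) ^ σ.card • Finsupp.single (T, insert s σ) 1 + contract R T₀ (T.erase s) σ := by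
  have hmin : (T \ T₀).min' ⟨s, hs.1⟩ = s := (Finset.isLeast_min' _ _).unique hs
  rw [contract, dif_pos ⟨s, hs.1⟩, hmin, if_neg hσ]

/-- The contracting homotopy of the cubical complex. -/
def cubeHomotopy (R : Type*) [CommRing R] {d : ℕ} (T₀ : Finset (Fin d)) :
    (Cell d →₀ R) →ₗ[R] (Cell d →₀ R) :=
  Finsupp.linearCombination R fun p => contract R T₀ p.1 p.2

theorem cubeHomotopy_single (R : Type*) [CommRing R] {d : ℕ} (T₀ T σ : Finset (Fin d)) :
    cubeHomotopy R T₀ (Finsupp.single (T, σ) 1) = contract R T₀ T σ := by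
  simp [cubeHomotopy]

theorem isLeast_erase {d : ℕ} {T₀ T : Finset (Fin d)} {s t : Fin d}
    (hs : IsLeast (T \ T₀ : Finset (Fin d)) s) (hst : s ≠ t) :
    IsLeast (T.erase t \ T₀ : Finset (Fin d)) s := by
  obtain ⟨h1, h2⟩ := hs
  simp only [Finset.coe_sdiff, Set.mem_sdiff, Finset.mem_coe] at h1
  refine ⟨by simp [h1, hst], fun j hj => h2 ?_⟩
  simp only [Finset.coe_sdiff, Set.mem_sdiff, Finset.mem_coe, Finset.mem_erase] at hj ⊢
  exact ⟨hj.1.2, hj.2⟩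

/-- Induction on `T.card`, splitting on whether the least element `s` of `T \ T₀` is a direction of
the cube. The condition `σ ⊆ T \ T₀` places `s` before all other directions, which fixes the signs.
-/
theorem cubeDiff_cubeHomotopy_add {R : Type*} [CommRing R] {d : ℕ} {T₀ : Finset (Fin d)}
    (T σ : Finset (Fin d)) (hT : T₀ ⊆ T) (hσ : σ ⊆ T \ T₀) :
    cubeDiff (1 : Fin d → R) 1 (cubeHomotopy R T₀ (Finsupp.single (T, σ) 1)) +
        cubeHomotopy R T₀ (cubeDiff (1 : Fin d → R) 1 (Finsupp.single (T, σ) 1)) =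
      Finsupp.single (T, σ) 1 - if σ = ∅ then Finsupp.single (T₀, ∅) 1 else 0 := by
  induction hn : T.card using Nat.strong_induction_on generalizing T σ with
  | _ n ih =>
  subst hn
  rw [cubeHomotopy_single]
  have hD : cubeHomotopy R T₀ (cubeDiff (1 : Fin d → R) 1 (Finsupp.single (T, σ) 1)) =
      ∑ t ∈ σ, (-1 : R) ^ alpha σ t •
        (contract R T₀ (T.erase t) (σ.erase t) - contract R T₀ T (σ.erase t)) := by
    rw [cubeDiff_single, one_smul, map_sum]
    refine Finset.sum_congr rfl fun t _ => ?_
    simp only [Pi.one_apply, map_smul, map_sub, cubeHomotopy_single]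
  by_cases hne : (T \ T₀).Nonempty
  swap
  · have hsub : T ⊆ T₀ := by
      rw [← Finset.sdiff_eq_empty_iff_subset]; exact Finset.not_nonempty_iff_eq_empty.1 hne
    obtain rfl : T = T₀ := hsub.antisymm hT
    obtain rfl : σ = ∅ := by simpa using hσ
    simp [contract_of_subset, hD]
  obtain ⟨s, hs⟩ : ∃ s, IsLeast (T \ T₀ : Finset (Fin d)) s :=
    ⟨(T \ T₀).min' hne, Finset.isLeast_min' _ hne⟩
  have hsT : s ∈ T ∧ s ∉ T₀ := Finset.mem_sdiff.1 hs.1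
  by_cases hsσ : s ∈ σ
  -- Faces in a direction `t ≠ s` still have `s` as least element and as direction, so they contract
  -- to zero. The two faces in direction `s` have contractions that differ by the prism over the
  -- original cube.
  · rw [contract_of_mem R hs hsσ, map_zero, zero_add, hD, Finset.sum_eq_single s]
    · rw [contract_of_notMem R hs (Finset.notMem_erase s σ), Finset.insert_erase hsσ]
      have hα : alpha σ s = (σ.erase s).card := by
        unfold alpha
        congr 1
        ext j
        simp only [Finset.mem_filter, Finset.mem_erase]
        constructor
        · rintro ⟨h1, h2⟩; exact ⟨h2.ne', h1⟩
        · rintro ⟨h1, h2⟩; exact ⟨h2, lt_of_le_of_ne (hs.2 (hσ h2)) h1.symm⟩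
      rw [hα, if_neg (Finset.ne_empty_of_mem hsσ), sub_zero, sub_add_cancel_right, neg_smul,
        neg_neg, smul_smul, ← mul_pow]
      simp
    · intro t _ hts
      rw [contract_of_mem R (isLeast_erase hs hts.symm) (by simp [hsσ, hts.symm]),
        contract_of_mem R hs (by simp [hsσ, hts.symm]), sub_zero, smul_zero]
    · exact fun h => absurd hsσ h
  -- The prism `(T, insert s σ)` has ends `(T, σ)` and `(T.erase s, σ)`; the second end is handled
  -- by the induction hypothesis.
  · have hlt : ∀ t ∈ σ, s < t := fun t ht =>
      lt_of_le_of_ne (hs.2 (hσ ht)) fun h => hsσ (h ▸ ht)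
    have hIH := ih _ (Finset.card_erase_lt_of_mem hsT.1) (T.erase s) σ
      (fun j hj => by
        have := hT hj
        simp only [Finset.mem_erase]
        exact ⟨fun h => hsT.2 (h ▸ hj), this⟩)
      (fun j hj => by
        have := Finset.mem_sdiff.1 (hσ hj)
        have := hlt j hj
        simp_all [this.ne']) rfl
    have hα : alpha (insert s σ) s = σ.card := by
      unfold alpha
      congr 1
      ext j
      simp only [Finset.mem_filter, Finset.mem_insert]
      constructor
      · rintro ⟨rfl | h1, h2⟩
        · exact absurd h2 (lt_irrefl _)
        · exact h1
      · exact fun h => ⟨Or.inr h, hlt j h⟩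
    -- Each side face of the prism over `σ` is the prism over a face of `σ`, with the opposite sign
    -- because `σ.erase t` has one element fewer. These terms cancel, leaving the corresponding sum
    -- for `T.erase s`.
    have hstep : ∀ t ∈ σ, (-1 : R) ^ alpha σ t •
        (contract R T₀ (T.erase t) (σ.erase t) - contract R T₀ T (σ.erase t)) =
        (-1 : R) ^ σ.card • ((-1 : R) ^ alpha (insert s σ) t •
          (Finsupp.single (T.erase t, (insert s σ).erase t) 1 -
            Finsupp.single (T, (insert s σ).erase t) 1)) +
        (-1 : R) ^ alpha σ t • (contract R T₀ ((T.erase s).erase t) (σ.erase t) -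
          contract R T₀ (T.erase s) (σ.erase t)) := by
      intro t ht
      have hst : s ≠ t := (hlt t ht).ne
      have hα' : alpha (insert s σ) t = alpha σ t := by
        rw [← alpha_erase_of_lt (σ := insert s σ) (hlt t ht), Finset.erase_insert hsσ]
      have hc : (-1 : R) ^ σ.card = -(-1) ^ (σ.erase t).card := by
        rw [← Finset.card_erase_add_one ht, pow_succ]; ring
      rw [contract_of_notMem R (isLeast_erase hs hst) (by simp [hsσ]),
        contract_of_notMem R hs (by simp [hsσ]), hα', Finset.erase_insert_of_ne hst, hc,
        Finset.erase_right_comm (s := T) (a := t) (b := s)]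
      module
    rw [cubeHomotopy_single, cubeDiff_single (σ := σ), one_smul, map_sum] at hIH
    simp only [Pi.one_apply, map_smul, map_sub, cubeHomotopy_single] at hIH
    rw [hD, Finset.sum_congr rfl hstep, Finset.sum_add_distrib, contract_of_notMem R hs hsσ,
      map_add, map_smul, cubeDiff_single, Finset.sum_insert hsσ, hα, Finset.erase_insert hsσ,
      ← Finset.smul_sum]
    simp only [Pi.one_apply]
    have hcancel : ∀ a Z : Cell d →₀ R, -(-1 : R) ^ σ.card •
        (1 : R) • ((-1 : R) ^ σ.card • a + Z) = -a - (-1 : R) ^ σ.card • Z := by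
      intro a Z
      have hsq : (-1 : R) ^ σ.card * (-1) ^ σ.card = 1 := by rw [← mul_pow]; simp
      rw [one_smul, neg_smul, smul_add, smul_smul, hsq, one_smul]
      abel
    generalize (∑ t ∈ σ, (-1 : R) ^ alpha (insert s σ) t •
          (Finsupp.single (T.erase t, (insert s σ).erase t) 1 -
            Finsupp.single (T, (insert s σ).erase t) 1) : Cell d →₀ R) = Z
    rw [← sub_eq_zero] at hIH ⊢
    refine Eq.trans ?_ hIH
    rw [hcancel]
    abel

/-! ### Minimal vertex covers as sets of indices -/

/-- The vertices `y_i` with `i ∈ T` and `x_i` with `i ∉ T`. -/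
def coverOf {d : ℕ} (T : Finset (Fin d)) : Finset (Fin d ⊕ Fin d) := Tᶜ.disjSum T

/-- The indices `i` with `y_i ∈ C`. -/
def yIndices {d : ℕ} (C : Finset (Fin d ⊕ Fin d)) : Finset (Fin d) :=
  Finset.univ.filter fun i => Sum.inr i ∈ C

@[simp]
theorem inl_mem_coverOf {d : ℕ} {T : Finset (Fin d)} {i : Fin d} :
    Sum.inl i ∈ coverOf T ↔ i ∉ T := by
  simp [coverOf]

@[simp]
theorem inr_mem_coverOf {d : ℕ} {T : Finset (Fin d)} {i : Fin d} :
    Sum.inr i ∈ coverOf T ↔ i ∈ T := by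
  simp [coverOf]

@[simp]
theorem yIndices_coverOf {d : ℕ} (T : Finset (Fin d)) : yIndices (coverOf T) = T := by
  ext; simp [yIndices]

theorem card_coverOf {d : ℕ} (T : Finset (Fin d)) : (coverOf T).card = d := by
  simp [coverOf]

theorem coverOf_erase {d : ℕ} (T : Finset (Fin d)) (s : Fin d) :
    insert (Sum.inl s) ((coverOf T).erase (Sum.inr s)) = coverOf (T.erase s) := by
  ext (i | i)
  · simp only [Finset.mem_insert, Finset.mem_erase, inl_mem_coverOf, Sum.inl.injEq]
    grind
  · simp only [Finset.mem_insert, Finset.mem_erase, inr_mem_coverOf]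
    grind

/-- Each matching edge forces at least one of `x_i`, `y_i` into `C`, and the size `d` of `C` leaves
no room for both. -/
theorem coverOf_yIndices {d : ℕ} {H : SimpleGraph (Fin d ⊕ Fin d)} (hH : IsVeryWellCovered H)
    (hl : IsStandardLabelled H) {C : Finset (Fin d ⊕ Fin d)} (hC : IsMinVertexCover H C) :
    coverOf (yIndices C) = C := by
  refine Finset.eq_of_subset_of_card_le ?_ ?_
  · rintro (i | i) hi
    · have h1 : Sum.inr i ∉ C := by simpa [yIndices] using hi
      simpa [h1] using hC.prop (hl.matching i)
    · simpa [yIndices] using hi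
  · have := hH.card_cover C hC
    simp only [Fintype.card_sum, Fintype.card_fin] at this
    rw [card_coverOf]
    omega

/-- The two conditions say that the edges `x_i y_j` and `x_i x_j` are covered; there are no edges
`y_i y_j`. Minimality is automatic, since `coverOf T` has half of the vertices. -/
theorem isMinVertexCover_coverOf_iff {d : ℕ} {H : SimpleGraph (Fin d ⊕ Fin d)}
    (hH : IsVeryWellCovered H) (hl : IsStandardLabelled H) {T : Finset (Fin d)} :
    IsMinVertexCover H (coverOf T) ↔
      (∀ i j, H.Adj (Sum.inl i) (Sum.inr j) → i ∈ T → j ∈ T) ∧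
        ∀ i j, H.Adj (Sum.inl i) (Sum.inl j) → ¬(i ∈ T ∧ j ∈ T) := by
  constructor
  · intro h
    refine ⟨fun i j hij hi => ?_, fun i j hij hT => ?_⟩
    · simpa [hi] using h.prop hij
    · simpa [hT.1, hT.2] using h.prop hij
  · rintro ⟨h1, h2⟩
    refine isMinVertexCover_of_card_le hH ?_ (by simp [card_coverOf, two_mul])
    rintro (i | i) (j | j) hij
    · have := h2 i j hij
      simp only [Finset.mem_coe, inl_mem_coverOf]
      tauto
    · have := h1 i j hij
      simp only [Finset.mem_coe, inl_mem_coverOf, inr_mem_coverOf]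
      tauto
    · have := h1 j i hij.symm
      simp only [Finset.mem_coe, inl_mem_coverOf, inr_mem_coverOf]
      tauto
    · exact absurd hij (hl.y_indep.prop (by simp) (by simp) hij.ne)

/-- The cubes all of whose vertices correspond to minimal vertex covers of `H`. -/
structure IsCoverCell {d : ℕ} (H : SimpleGraph (Fin d ⊕ Fin d)) (p : Cell d) : Prop where
  isMin : IsMinVertexCover H (coverOf p.1)
  subset : p.2 ⊆ p.1
  isMin_erase : ∀ s ∈ p.2, IsMinVertexCover H (coverOf (p.1.erase s))

/-- An uncovered edge `x_i y_j` would involve only one deleted index `j ∈ σ`, so it would already be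
uncovered for `T.erase j`. Checking single deletions therefore suffices. -/
theorem isMinVertexCover_coverOf_sdiff {d : ℕ} {H : SimpleGraph (Fin d ⊕ Fin d)}
    (hH : IsVeryWellCovered H) (hl : IsStandardLabelled H) {T σ : Finset (Fin d)}
    (h : IsCoverCell H (T, σ)) : IsMinVertexCover H (coverOf (T \ σ)) := by
  obtain ⟨h1, -, h3⟩ := h
  simp only [isMinVertexCover_coverOf_iff hH hl] at h1 h3 ⊢
  refine ⟨fun i j hij hi => ?_, fun i j hij hT => h1.2 i j hij ?_⟩
  · rw [Finset.mem_sdiff] at hi ⊢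
    refine ⟨h1.1 i j hij hi.1, fun hj => ?_⟩
    have := (h3 j hj).1 i j hij (Finset.mem_erase.2 ⟨fun e => hi.2 (e ▸ hj), hi.1⟩)
    simp at this
  · simp only [Finset.mem_sdiff] at hT
    exact ⟨hT.1.1, hT.2.1⟩

theorem IsCoverCell.erase_right {d : ℕ} {H : SimpleGraph (Fin d ⊕ Fin d)} {T σ : Finset (Fin d)}
    (h : IsCoverCell H (T, σ)) (s : Fin d) : IsCoverCell H (T, σ.erase s) :=
  ⟨h.isMin, (Finset.erase_subset _ _).trans h.subset,
    fun t ht => h.isMin_erase t (Finset.mem_of_mem_erase ht)⟩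

theorem IsCoverCell.erase_left {d : ℕ} {H : SimpleGraph (Fin d ⊕ Fin d)}
    (hH : IsVeryWellCovered H) (hl : IsStandardLabelled H) {T σ : Finset (Fin d)} {s : Fin d}
    (h : IsCoverCell H (T, σ)) (hs : IsMinVertexCover H (coverOf (T.erase s))) (hsσ : s ∉ σ) :
    IsCoverCell H (T.erase s, σ) := by
  refine ⟨hs, fun t ht => Finset.mem_erase.2 ⟨fun e => hsσ (e ▸ ht), h.subset ht⟩,
    fun t ht => ?_⟩
  have ht' := h.isMin_erase t ht
  have h1 := h.isMin
  simp only [isMinVertexCover_coverOf_iff hH hl] at h1 hs ht' ⊢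
  refine ⟨fun i j hij hi => ?_, fun i j hij hT => h1.2 i j hij ?_⟩
  · have h2 := hs.1 i j hij (Finset.mem_of_mem_erase hi)
    have h3 := ht'.1 i j hij
      (Finset.mem_erase.2 ⟨Finset.ne_of_mem_erase hi,
        Finset.mem_of_mem_erase (Finset.mem_of_mem_erase hi)⟩)
    exact Finset.mem_erase.2 ⟨Finset.ne_of_mem_erase h3, h2⟩
  · simp only [Finset.mem_erase] at hT
    exact ⟨hT.1.2.2, hT.2.2.2⟩

theorem IsCoverCell.face {d : ℕ} {H : SimpleGraph (Fin d ⊕ Fin d)}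
    (hH : IsVeryWellCovered H) (hl : IsStandardLabelled H) {T σ : Finset (Fin d)} {s : Fin d}
    (h : IsCoverCell H (T, σ)) (hs : s ∈ σ) : IsCoverCell H (T.erase s, σ.erase s) :=
  (h.erase_right s).erase_left hH hl (h.isMin_erase s hs) (Finset.notMem_erase s σ)

open Classical in
/-- The intersection of all `T ⊇ Bᶜ` that correspond to minimal vertex covers. -/
def leastCover {d : ℕ} (H : SimpleGraph (Fin d ⊕ Fin d)) (B : Finset (Fin d)) : Finset (Fin d) :=
  Finset.univ.filter fun i => ∀ T, IsMinVertexCover H (coverOf T) → Bᶜ ⊆ T → i ∈ T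

theorem mem_leastCover {d : ℕ} {H : SimpleGraph (Fin d ⊕ Fin d)} {B : Finset (Fin d)}
    {i : Fin d} :
    i ∈ leastCover H B ↔ ∀ T, IsMinVertexCover H (coverOf T) → Bᶜ ⊆ T → i ∈ T := by
  simp [leastCover]

theorem compl_subset_leastCover {d : ℕ} (H : SimpleGraph (Fin d ⊕ Fin d)) (B : Finset (Fin d)) :
    Bᶜ ⊆ leastCover H B :=
  fun _ hi => mem_leastCover.2 fun _ _ hT => hT hi

theorem leastCover_subset {d : ℕ} {H : SimpleGraph (Fin d ⊕ Fin d)} {B T : Finset (Fin d)}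
    (hT : IsMinVertexCover H (coverOf T)) (hB : Bᶜ ⊆ T) : leastCover H B ⊆ T :=
  fun _ hi => mem_leastCover.1 hi T hT hB

/-- The closure condition survives intersections, and the absence of edges `x_i x_j` passes to
subsets. The given `T` guarantees that the intersection is not over an empty family. -/
theorem leastCover_isMin {d : ℕ} {H : SimpleGraph (Fin d ⊕ Fin d)} (hH : IsVeryWellCovered H)
    (hl : IsStandardLabelled H) {B T : Finset (Fin d)}
    (hT : IsMinVertexCover H (coverOf T)) (hB : Bᶜ ⊆ T) :
    IsMinVertexCover H (coverOf (leastCover H B)) := by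
  refine (isMinVertexCover_coverOf_iff hH hl).2 ⟨fun i j hij hi => ?_, fun i j hij hi => ?_⟩
  · rw [mem_leastCover] at hi ⊢
    exact fun T' hT' hB' => ((isMinVertexCover_coverOf_iff hH hl).1 hT').1 i j hij (hi T' hT' hB')
  · exact ((isMinVertexCover_coverOf_iff hH hl).1 hT).2 i j hij
      ⟨leastCover_subset hT hB hi.1, leastCover_subset hT hB hi.2⟩

/-- The least element outside a smaller cover can be exchanged; this is where the order of the
labelling enters. -/
theorem isMinVertexCover_erase_of_isLeast {d : ℕ} {H : SimpleGraph (Fin d ⊕ Fin d)}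
    (hH : IsVeryWellCovered H) (hl : IsStandardLabelled H) {T₀ T : Finset (Fin d)} {s : Fin d}
    (hT₀ : IsMinVertexCover H (coverOf T₀)) (hT : IsMinVertexCover H (coverOf T))
    (hs : IsLeast (T \ T₀ : Finset (Fin d)) s) : IsMinVertexCover H (coverOf (T.erase s)) := by
  rw [isMinVertexCover_coverOf_iff hH hl] at *
  have hsT : s ∈ T ∧ s ∉ T₀ := Finset.mem_sdiff.1 hs.1
  refine ⟨fun i j hij hi => ?_, fun i j hij hi => hT.2 i j hij
    ⟨Finset.mem_of_mem_erase hi.1, Finset.mem_of_mem_erase hi.2⟩⟩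
  rw [Finset.mem_erase] at hi ⊢
  refine ⟨?_, hT.1 i j hij hi.2⟩
  rintro rfl
  -- The only obstruction is an edge from some `x_i` with `i` left in `T` to the deleted `y`-vertex.
  -- If `i ∈ T₀`, closure of `T₀` puts the deleted index in `T₀`. Otherwise minimality and the
  -- labelling give opposite inequalities, so `i` is the deleted index itself.
  by_cases hi0 : i ∈ T₀
  · exact hsT.2 (hT₀.1 i j hij hi0)
  · exact hi.1 (le_antisymm (hl.le_of_adj i j hij) (hs.2 (Finset.mem_sdiff.2 ⟨hi.2, hi0⟩)))

/-- The cubes `(T, σ)` of the subcomplex cut out by the conditions `T ⊆ A` and `T \ σ ⊇ Bᶜ`. -/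
structure IsStrandCell {d : ℕ} (H : SimpleGraph (Fin d ⊕ Fin d)) (A B : Finset (Fin d))
    (p : Cell d) : Prop extends IsCoverCell H p where
  le_A : p.1 ⊆ A
  le_B : Bᶜ ⊆ p.1 \ p.2

theorem IsStrandCell.leastCover_subset {d : ℕ} {H : SimpleGraph (Fin d ⊕ Fin d)}
    (hH : IsVeryWellCovered H) (hl : IsStandardLabelled H) {A B T σ : Finset (Fin d)}
    (h : IsStrandCell H A B (T, σ)) : leastCover H B ⊆ T \ σ :=
  CoverResolution.leastCover_subset (isMinVertexCover_coverOf_sdiff hH hl h.toIsCoverCell) h.le_B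

/-- The contraction stays inside the strand and raises dimension by one: each deleted `s` lies
outside the least cover, hence outside `Bᶜ`, and its deletion gives a cover again. -/
theorem IsStrandCell.contract_mem {d : ℕ} {H : SimpleGraph (Fin d ⊕ Fin d)}
    (hH : IsVeryWellCovered H) (hl : IsStandardLabelled H) (R : Type*) [CommRing R]
    {A B T σ : Finset (Fin d)} (h : IsStrandCell H A B (T, σ)) :
    contract R (leastCover H B) T σ ∈
      Finsupp.supported R R {q : Cell d | IsStrandCell H A B q ∧ q.2.card = σ.card + 1} := by
  induction hn : T.card using Nat.strong_induction_on generalizing T with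
  | _ n ih =>
  subst hn
  by_cases hne : (T \ leastCover H B).Nonempty
  swap
  · rw [contract_of_subset]
    · exact Submodule.zero_mem _
    · rw [← Finset.sdiff_eq_empty_iff_subset]; exact Finset.not_nonempty_iff_eq_empty.1 hne
  obtain ⟨s, hs⟩ : ∃ s, IsLeast (T \ leastCover H B : Finset (Fin d)) s :=
    ⟨(T \ leastCover H B).min' hne, Finset.isLeast_min' _ hne⟩
  have hsT : s ∈ T ∧ s ∉ leastCover H B := Finset.mem_sdiff.1 hs.1
  by_cases hsσ : s ∈ σ
  · rw [contract_of_mem R hs hsσ]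
    exact Submodule.zero_mem _
  have hsub := h.leastCover_subset hH hl
  have hmin : IsMinVertexCover H (coverOf (T.erase s)) :=
    isMinVertexCover_erase_of_isLeast hH hl (leastCover_isMin hH hl h.isMin
      (h.le_B.trans Finset.sdiff_subset)) h.isMin hs
  have hB : ∀ j ∈ Bᶜ, j ≠ s := fun j hj e => hsT.2 (e ▸ compl_subset_leastCover H B hj)
  rw [contract_of_notMem R hs hsσ]
  refine Submodule.add_mem _ (Submodule.smul_mem _ _ (Finsupp.single_mem_supported _ _ ?_)) ?_
  · refine ⟨⟨⟨h.isMin, ?_, ?_⟩, h.le_A, ?_⟩, Finset.card_insert_of_notMem hsσ⟩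
    · exact Finset.insert_subset hsT.1 h.subset
    · intro t ht
      rcases Finset.mem_insert.1 ht with rfl | ht
      · exact hmin
      · exact h.isMin_erase t ht
    · intro j hj
      have := Finset.mem_sdiff.1 (h.le_B hj)
      simpa [hB j hj] using this
  · refine ih _ (Finset.card_erase_lt_of_mem hsT.1) ⟨h.erase_left hH hl hmin hsσ,
      (Finset.erase_subset _ _).trans h.le_A, fun j hj => ?_⟩ rfl
    have := Finset.mem_sdiff.1 (h.le_B hj)
    simpa [hB j hj] using this

/-! ### Exponent vectors -/

/-- The exponent vector of `x'_i` or `y'_i`. -/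
def primedExp {d : ℕ} {n : Fin d → ℕ} {V : Type*} (e : BlowUpVertex n ≃ V)
    (v : Fin d ⊕ Fin d) : V →₀ ℕ :=
  ∑ j : Fin (n (idx v)), Finsupp.single (e ⟨v, j⟩) 1

theorem primed_eq_monomial (k : Type*) [Field k] {d : ℕ} {n : Fin d → ℕ} {V : Type*}
    (e : BlowUpVertex n ≃ V) (v : Fin d ⊕ Fin d) :
    primed k e v = monomial (primedExp e v) 1 := by
  rw [primedExp, monomial_sum_one]
  rfl

theorem primedExp_apply_of_ne {d : ℕ} {n : Fin d → ℕ} {V : Type*} (e : BlowUpVertex n ≃ V)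
    {u v : Fin d ⊕ Fin d} (huv : u ≠ v) (j : Fin (n (idx u))) :
    primedExp e v (e ⟨u, j⟩) = 0 := by
  classical
  rw [primedExp, Finsupp.finsetSum_apply]
  refine Finset.sum_eq_zero fun l _ => ?_
  rw [Finsupp.single_apply, if_neg]
  intro h
  exact huv (congrArg Sigma.fst (e.injective h)).symm

/-- The monomials `x'_i`, `y'_i` have pairwise disjoint supports, so a product of distinct ones
divides a monomial as soon as each factor does. -/
theorem sum_primedExp_le_iff {d : ℕ} {n : Fin d → ℕ} {V : Type*} (e : BlowUpVertex n ≃ V)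
    (C : Finset (Fin d ⊕ Fin d)) (a : V →₀ ℕ) :
    ∑ v ∈ C, primedExp e v ≤ a ↔ ∀ v ∈ C, primedExp e v ≤ a := by
  refine ⟨fun h v hv => (Finset.single_le_sum (fun _ _ => zero_le) hv).trans h,
    fun h w => ?_⟩
  obtain ⟨⟨u, j⟩, rfl⟩ := e.surjective w
  rw [Finsupp.finsetSum_apply]
  by_cases hu : u ∈ C
  · rw [Finset.sum_eq_single_of_mem u hu fun v _ hv => primedExp_apply_of_ne e hv.symm j]
    exact h u hu _
  · rw [Finset.sum_eq_zero fun v hv => primedExp_apply_of_ne e (ne_of_mem_of_not_mem hv hu).symm j]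
    exact Nat.zero_le _

/-- The exponent vector of the degree of the cube `(T, σ)`. -/
def cellExp {d : ℕ} {n : Fin d → ℕ} {V : Type*} (e : BlowUpVertex n ≃ V) (p : Cell d) :
    V →₀ ℕ :=
  ∑ v ∈ (p.1 \ p.2)ᶜ.disjSum p.1, primedExp e v

open Classical in
/-- The indices `i` such that `x'_i` divides the monomial with exponent vector `a`. -/
def xDivisors {d : ℕ} {n : Fin d → ℕ} {V : Type*} (e : BlowUpVertex n ≃ V) (a : V →₀ ℕ) :
    Finset (Fin d) :=
  Finset.univ.filter fun i => primedExp e (Sum.inl i) ≤ a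

open Classical in
/-- The indices `i` such that `y'_i` divides the monomial with exponent vector `a`. -/
def yDivisors {d : ℕ} {n : Fin d → ℕ} {V : Type*} (e : BlowUpVertex n ≃ V) (a : V →₀ ℕ) :
    Finset (Fin d) :=
  Finset.univ.filter fun i => primedExp e (Sum.inr i) ≤ a

theorem cellExp_le_iff {d : ℕ} {n : Fin d → ℕ} {V : Type*} (e : BlowUpVertex n ≃ V)
    {p : Cell d} {a : V →₀ ℕ} :
    cellExp e p ≤ a ↔ p.1 ⊆ yDivisors e a ∧ (xDivisors e a)ᶜ ⊆ p.1 \ p.2 := by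
  have hc : (xDivisors e a)ᶜ ⊆ p.1 \ p.2 ↔ (p.1 \ p.2)ᶜ ⊆ xDivisors e a := compl_le_iff_compl_le
  rw [cellExp, sum_primedExp_le_iff, hc]
  constructor
  · intro h
    exact ⟨fun i hi => by simpa [yDivisors] using h (Sum.inr i) (by simpa using hi),
      fun i hi => by simpa [xDivisors] using h (Sum.inl i) (by simpa using hi)⟩
  · rintro ⟨h1, h2⟩ (i | i) hi
    · simpa [xDivisors] using h2 (Finset.inl_mem_disjSum.1 hi)
    · simpa [yDivisors] using h1 (Finset.inr_mem_disjSum.1 hi)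

theorem isStrandCell_iff {d : ℕ} {H : SimpleGraph (Fin d ⊕ Fin d)} {n : Fin d → ℕ} {V : Type*}
    (e : BlowUpVertex n ≃ V) {p : Cell d} {a : V →₀ ℕ} :
    IsStrandCell H (yDivisors e a) (xDivisors e a) p ↔ IsCoverCell H p ∧ cellExp e p ≤ a := by
  rw [cellExp_le_iff]
  exact ⟨fun h => ⟨h.toIsCoverCell, h.le_A, h.le_B⟩, fun h => ⟨h.1, h.2.1, h.2.2⟩⟩

theorem cellExp_face {d : ℕ} {n : Fin d → ℕ} {V : Type*} (e : BlowUpVertex n ≃ V)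
    {T σ : Finset (Fin d)} {s : Fin d} (hσ : σ ⊆ T) (hs : s ∈ σ) :
    cellExp e (T.erase s, σ.erase s) + primedExp e (Sum.inr s) = cellExp e (T, σ) := by
  have h : T.erase s \ σ.erase s = T \ σ := by
    ext j
    simp only [Finset.mem_sdiff, Finset.mem_erase]
    grind
  simp only [cellExp, Finset.sum_disjSum, h]
  rw [add_assoc, Finset.sum_erase_add _ _ (hσ hs)]

theorem cellExp_erase_right {d : ℕ} {n : Fin d → ℕ} {V : Type*} (e : BlowUpVertex n ≃ V)
    {T σ : Finset (Fin d)} {s : Fin d} (hσ : σ ⊆ T) (hs : s ∈ σ) :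
    cellExp e (T, σ.erase s) + primedExp e (Sum.inl s) = cellExp e (T, σ) := by
  have h : (T \ σ.erase s)ᶜ = (T \ σ)ᶜ.erase s := by
    ext j
    simp only [Finset.mem_sdiff, Finset.mem_erase, Finset.mem_compl]
    grind
  simp only [cellExp, Finset.sum_disjSum, h]
  rw [add_right_comm, Finset.sum_erase_add _ _ (by simp [hs])]

/-! ### Strands of the complex -/

/-- The differential of the resolution, extended to all pairs of finite sets. -/
def cellDiff (k : Type*) [Field k] {d : ℕ} {n : Fin d → ℕ} {V : Type*} (e : BlowUpVertex n ≃ V) :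
    (Cell d →₀ MvPolynomial V k) →ₗ[MvPolynomial V k] (Cell d →₀ MvPolynomial V k) :=
  cubeDiff (fun s => primed k e (Sum.inr s)) fun s => primed k e (Sum.inl s)

/-- The augmentation, extended to all pairs of finite sets. -/
def cellAug (k : Type*) [Field k] {d : ℕ} {n : Fin d → ℕ} {V : Type*} (e : BlowUpVertex n ≃ V) :
    (Cell d →₀ MvPolynomial V k) →ₗ[MvPolynomial V k] MvPolynomial V k :=
  Finsupp.linearCombination _ fun p => if p.2 = ∅ then monomial (cellExp e p) 1 else 0

/-- The inclusion of the part of fine degree `a`. -/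
def strand (k : Type*) [Field k] {d : ℕ} {n : Fin d → ℕ} {V : Type*} (e : BlowUpVertex n ≃ V)
    (a : V →₀ ℕ) : (Cell d →₀ k) →ₗ[k] (Cell d →₀ MvPolynomial V k) :=
  Finsupp.linearCombination k fun p => Finsupp.single p (monomial (a - cellExp e p) 1)

theorem strand_single (k : Type*) [Field k] {d : ℕ} {n : Fin d → ℕ} {V : Type*}
    (e : BlowUpVertex n ≃ V) (a : V →₀ ℕ) (p : Cell d) :
    strand k e a (Finsupp.single p 1) = Finsupp.single p (monomial (a - cellExp e p) 1) := by
  simp [strand]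

theorem linearMap_eqOn_supported {R M N : Type*} [CommRing R] [AddCommGroup N] [Module R N]
    {f g : (M →₀ R) →ₗ[R] N} {s : Set M}
    (h : ∀ p ∈ s, f (Finsupp.single p 1) = g (Finsupp.single p 1)) {w : M →₀ R}
    (hw : w ∈ Finsupp.supported R R s) : f w = g w := by
  rw [Finsupp.supported_eq_span_single] at hw
  refine LinearMap.eqOn_span (s := (fun i => Finsupp.single i (1 : R)) '' s) ?_ hw
  rintro _ ⟨p, hp, rfl⟩
  exact h p hp

/-- Passing to a face lowers the degree of the cell by exactly the weight, so the weight is absorbed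
by the complementary monomial. The bound `cellExp e p ≤ a` keeps the truncated subtraction honest.
-/
theorem cellDiff_strand_single (k : Type*) [Field k] {d : ℕ} {n : Fin d → ℕ} {V : Type*}
    (e : BlowUpVertex n ≃ V) {a : V →₀ ℕ} {p : Cell d} (hp : p.2 ⊆ p.1) (ha : cellExp e p ≤ a) :
    cellDiff k e (strand k e a (Finsupp.single p 1)) =
      strand k e a (cubeDiff 1 1 (Finsupp.single p 1)) := by
  obtain ⟨T, σ⟩ := p
  rw [strand_single, cellDiff, cubeDiff_single, cubeDiff_single, one_smul, map_sum,
    Finset.smul_sum]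
  refine Finset.sum_congr rfl fun s hs => ?_
  have h1 : monomial (a - cellExp e (T, σ)) 1 * primed k e (Sum.inr s) =
      monomial (a - cellExp e (T.erase s, σ.erase s)) 1 := by
    rw [primed_eq_monomial, monomial_mul, one_mul]
    congr 2
    rw [← cellExp_face e hp hs] at ha ⊢
    ext w
    have := ha w
    simp only [Finsupp.coe_add, Finsupp.coe_tsub, Pi.add_apply, Pi.sub_apply] at this ⊢
    omega
  have h2 : monomial (a - cellExp e (T, σ)) 1 * primed k e (Sum.inl s) =
      monomial (a - cellExp e (T, σ.erase s)) 1 := by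
    rw [primed_eq_monomial, monomial_mul, one_mul]
    congr 2
    rw [← cellExp_erase_right e hp hs] at ha ⊢
    ext w
    have := ha w
    simp only [Finsupp.coe_add, Finsupp.coe_tsub, Pi.add_apply, Pi.sub_apply] at this ⊢
    omega
  rw [map_smul, map_sub]
  simp only [Pi.one_apply]
  rw [strand_single, strand_single, ← h1, ← h2,
    smul_comm]
  simp only [smul_sub, Finsupp.smul_single, smul_eq_mul]
  -- The sign acts through the polynomial ring on one side and through `k` on the other.
  rcases neg_one_pow_eq_or k (alpha σ s) with h | h <;>
    rcases Nat.even_or_odd (alpha σ s) with h' | h' <;> simp [h'.neg_one_pow]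

theorem cellDiff_strand (k : Type*) [Field k] {d : ℕ} {n : Fin d → ℕ} {V : Type*}
    (e : BlowUpVertex n ≃ V) {a : V →₀ ℕ} {s : Set (Cell d)}
    (hs : ∀ p ∈ s, p.2 ⊆ p.1 ∧ cellExp e p ≤ a) {w : Cell d →₀ k}
    (hw : w ∈ Finsupp.supported k k s) :
    cellDiff k e (strand k e a w) = strand k e a (cubeDiff 1 1 w) :=
  linearMap_eqOn_supported (f := (cellDiff k e).restrictScalars k ∘ₗ strand k e a)
    (g := strand k e a ∘ₗ cubeDiff 1 1)
    (fun p hp => cellDiff_strand_single k e (hs p hp).1 (hs p hp).2) hw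

theorem constr_basisMonomials {k V N : Type*} [Field k] [AddCommGroup N] [Module k N]
    (f : (V →₀ ℕ) → N) (u : V →₀ ℕ) :
    (basisMonomials V k).constr k f (monomial u 1) = f u := by
  have := (basisMonomials V k).constr_basis k f u
  rwa [coe_basisMonomials] at this

/-- The contracting homotopy of the resolution, acting on each strand as the contracting homotopy
of a cubical complex. -/
def cellHomotopy (k : Type*) [Field k] {d : ℕ} (H : SimpleGraph (Fin d ⊕ Fin d)) {n : Fin d → ℕ}
    {V : Type*} (e : BlowUpVertex n ≃ V) :
    (Cell d →₀ MvPolynomial V k) →ₗ[k] (Cell d →₀ MvPolynomial V k) :=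
  Finsupp.lsum k fun p => (basisMonomials V k).constr k fun u =>
    strand k e (u + cellExp e p)
      (contract k (leastCover H (xDivisors e (u + cellExp e p))) p.1 p.2)

theorem cellHomotopy_single (k : Type*) [Field k] {d : ℕ} (H : SimpleGraph (Fin d ⊕ Fin d))
    {n : Fin d → ℕ} {V : Type*} (e : BlowUpVertex n ≃ V) (p : Cell d) (u : V →₀ ℕ) :
    cellHomotopy k H e (Finsupp.single p (monomial u 1)) = strand k e (u + cellExp e p)
      (contract k (leastCover H (xDivisors e (u + cellExp e p))) p.1 p.2) := by
  rw [cellHomotopy, Finsupp.lsum_single, constr_basisMonomials]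

/-- The contraction target depends on the degree only, so it is common to all cells of a strand. It
does change with the degree, which is why the homotopy is taken only `k`-linear. -/
theorem cellHomotopy_strand (k : Type*) [Field k] {d : ℕ} (H : SimpleGraph (Fin d ⊕ Fin d))
    {n : Fin d → ℕ} {V : Type*} (e : BlowUpVertex n ≃ V) {a : V →₀ ℕ} {s : Set (Cell d)}
    (hs : ∀ p ∈ s, cellExp e p ≤ a) {w : Cell d →₀ k} (hw : w ∈ Finsupp.supported k k s) :
    cellHomotopy k H e (strand k e a w) =
      strand k e a (cubeHomotopy k (leastCover H (xDivisors e a)) w) := by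
  refine linearMap_eqOn_supported (f := cellHomotopy k H e ∘ₗ strand k e a)
    (g := strand k e a ∘ₗ cubeHomotopy k (leastCover H (xDivisors e a))) (fun p hp => ?_) hw
  rw [LinearMap.comp_apply, LinearMap.comp_apply, strand_single, cellHomotopy_single,
    tsub_add_cancel_of_le (hs p hp), cubeHomotopy_single]

/-- The section of the augmentation that is compatible with the contracting homotopy. -/
def cellSection (k : Type*) [Field k] {d : ℕ} (H : SimpleGraph (Fin d ⊕ Fin d)) {n : Fin d → ℕ}
    {V : Type*} (e : BlowUpVertex n ≃ V) : MvPolynomial V k →ₗ[k] (Cell d →₀ MvPolynomial V k) :=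
  (basisMonomials V k).constr k fun a =>
    strand k e a (Finsupp.single (leastCover H (xDivisors e a), ∅) 1)

theorem cubeDiff_single_mem_supported {d : ℕ} {H : SimpleGraph (Fin d ⊕ Fin d)}
    (hH : IsVeryWellCovered H) (hl : IsStandardLabelled H) (R : Type*) [CommRing R]
    {A B : Finset (Fin d)} {p : Cell d} (h : IsStrandCell H A B p) :
    cubeDiff (1 : Fin d → R) 1 (Finsupp.single p 1) ∈
      Finsupp.supported R R {q | IsStrandCell H A B q} := by
  obtain ⟨T, σ⟩ := p
  rw [cubeDiff_single, one_smul]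
  refine Submodule.sum_mem _ fun s hs => Submodule.smul_mem _ _ (Submodule.sub_mem _ ?_ ?_)
  · refine Finsupp.single_mem_supported _ _ ⟨h.toIsCoverCell.face hH hl hs,
      (Finset.erase_subset _ _).trans h.le_A, fun j hj => ?_⟩
    have := Finset.mem_sdiff.1 (h.le_B hj)
    grind
  · refine Finsupp.single_mem_supported _ _ ⟨h.toIsCoverCell.erase_right s, h.le_A, fun j hj => ?_⟩
    have := Finset.mem_sdiff.1 (h.le_B hj)
    grind

theorem cellDiff_cellHomotopy_add (k : Type*) [Field k] {d : ℕ} {H : SimpleGraph (Fin d ⊕ Fin d)}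
    (hH : IsVeryWellCovered H) (hl : IsStandardLabelled H) {n : Fin d → ℕ} {V : Type*}
    (e : BlowUpVertex n ≃ V) {p : Cell d} (hp : IsCoverCell H p) (u : V →₀ ℕ) :
    cellDiff k e (cellHomotopy k H e (Finsupp.single p (monomial u 1))) +
        cellHomotopy k H e (cellDiff k e (Finsupp.single p (monomial u 1))) +
        cellSection k H e (cellAug k e (Finsupp.single p (monomial u 1))) =
      Finsupp.single p (monomial u 1) := by
  obtain ⟨T, σ⟩ := p
  obtain ⟨a, ha⟩ : ∃ a, u + cellExp e (T, σ) = a := ⟨_, rfl⟩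
  have hle : cellExp e (T, σ) ≤ a := ha ▸ le_add_self
  have hstrand : IsStrandCell H (yDivisors e a) (xDivisors e a) (T, σ) :=
    (isStrandCell_iff e).2 ⟨hp, hle⟩
  have hu : Finsupp.single (T, σ) (monomial u (1 : k)) =
      strand k e a (Finsupp.single (T, σ) 1) := by
    rw [strand_single, ← ha, add_tsub_cancel_right]
  have hle' : ∀ q ∈ {q | IsStrandCell H (yDivisors e a) (xDivisors e a) q},
      cellExp e q ≤ a := fun q hq => ((isStrandCell_iff e).1 hq).2
  have h1 : cellDiff k e (cellHomotopy k H e (Finsupp.single (T, σ) (monomial u 1))) =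
      strand k e a (cubeDiff 1 1 (cubeHomotopy k (leastCover H (xDivisors e a))
        (Finsupp.single (T, σ) 1))) := by
    rw [cellHomotopy_single, ha, cellDiff_strand k e _ (hstrand.contract_mem hH hl k),
      cubeHomotopy_single]
    exact fun q hq => ⟨hq.1.subset, hle' q hq.1⟩
  have h2 : cellHomotopy k H e (cellDiff k e (Finsupp.single (T, σ) (monomial u 1))) =
      strand k e a (cubeHomotopy k (leastCover H (xDivisors e a)) (cubeDiff 1 1
        (Finsupp.single (T, σ) 1))) := by
    rw [hu, cellDiff_strand_single k e hp.subset hle,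
      cellHomotopy_strand k H e hle' (cubeDiff_single_mem_supported hH hl k hstrand)]
  have h3 : cellSection k H e (cellAug k e (Finsupp.single (T, σ) (monomial u 1))) =
      strand k e a (if σ = ∅ then Finsupp.single (leastCover H (xDivisors e a), ∅) 1 else 0) := by
    rw [cellAug, Finsupp.linearCombination_single]
    split_ifs with h
    · rw [smul_eq_mul, monomial_mul, ha, one_mul, cellSection, constr_basisMonomials]
    · simp
  -- The target lies in the smallest vertex `T \ σ` of the cube, which gives both hypotheses of the
  -- cubical identity. The strand being inhabited, the target is a genuine cover.
  have hsub := hstrand.leastCover_subset hH hl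
  rw [h1, h2, h3, ← map_add, ← map_add, cubeDiff_cubeHomotopy_add T σ
    (hsub.trans Finset.sdiff_subset), sub_add_cancel, hu]
  intro j hj
  exact Finset.mem_sdiff.2 ⟨hp.subset hj, fun h => (Finset.mem_sdiff.1 (hsub h)).2 hj⟩

theorem cellAug_cellDiff (k : Type*) [Field k] {d : ℕ} {n : Fin d → ℕ} {V : Type*}
    (e : BlowUpVertex n ≃ V) {p : Cell d} (hp : p.2 ⊆ p.1) (r : MvPolynomial V k) :
    cellAug k e (cellDiff k e (Finsupp.single p r)) = 0 := by
  obtain ⟨T, σ⟩ := p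
  rw [cellDiff, cubeDiff_single, map_smul, map_sum, Finset.sum_eq_zero, smul_zero]
  intro s hs
  rw [map_smul, map_sub, cellAug, Finsupp.linearCombination_single,
    Finsupp.linearCombination_single]
  split_ifs
  · simp only [smul_eq_mul, primed_eq_monomial, monomial_mul]
    rw [add_comm (primedExp e (Sum.inr s)), cellExp_face e hp hs, add_comm (primedExp e (Sum.inl s)),
      cellExp_erase_right e hp hs, sub_self, mul_zero]
  · simp

/-! ### Comparison of the symbols with the cubes -/

/-- The cube belonging to the symbol `f(C; σ)`. -/
def Symb.toCell {d : ℕ} {H : SimpleGraph (Fin d ⊕ Fin d)} {i : ℕ} (p : Symb H i) : Cell d :=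
  (yIndices p.C, p.σ)

theorem Symb.toCell_injective {d : ℕ} {H : SimpleGraph (Fin d ⊕ Fin d)}
    (hH : IsVeryWellCovered H) (hl : IsStandardLabelled H) (i : ℕ) :
    Function.Injective (Symb.toCell : Symb H i → Cell d) := by
  intro p q h
  simp only [Symb.toCell, Prod.mk.injEq] at h
  refine Symb.ext ?_ h.2
  rw [← coverOf_yIndices hH hl p.isMin, h.1, coverOf_yIndices hH hl q.isMin]

theorem Symb.isCoverCell {d : ℕ} {H : SimpleGraph (Fin d ⊕ Fin d)}
    (hH : IsVeryWellCovered H) (hl : IsStandardLabelled H) {i : ℕ} (p : Symb H i) :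
    IsCoverCell H p.toCell := by
  have hC := coverOf_yIndices hH hl p.isMin
  refine ⟨?_, fun s hs => ?_, fun s hs => ?_⟩
  · rw [Symb.toCell, hC]
    exact p.isMin
  · simpa [Symb.toCell, yIndices] using (mem_swapSet.1 (p.subset hs)).1
  · rw [Symb.toCell, ← coverOf_erase, hC]
    exact (mem_swapSet.1 (p.subset hs)).2

/-- With injectivity of `Symb.toCell`, this identifies the symbols in degree `i` with the
`i`-dimensional cover cells. -/
theorem IsCoverCell.exists_symb {d : ℕ} {H : SimpleGraph (Fin d ⊕ Fin d)} {q : Cell d}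
    (hq : IsCoverCell H q) {i : ℕ} (hi : q.2.card = i) : ∃ p : Symb H i, p.toCell = q := by
  refine ⟨⟨coverOf q.1, q.2, hq.isMin, fun s hs => ?_, hi⟩, ?_⟩
  · rw [mem_swapSet, coverOf_erase]
    exact ⟨by simpa using hq.subset hs, hq.isMin_erase s hs⟩
  · simp [Symb.toCell]

theorem Symb.toCell_swap {d : ℕ} {H : SimpleGraph (Fin d ⊕ Fin d)} (hH : IsVeryWellCovered H)
    (hl : IsStandardLabelled H) {i : ℕ} (p : Symb H (i + 1)) (s : Fin d) (hs : s ∈ p.σ) :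
    (p.swap hH hl s hs).toCell = ((yIndices p.C).erase s, p.σ.erase s) := by
  simp only [Symb.toCell, Symb.swap, Prod.mk.injEq, and_true]
  ext j
  simp [yIndices]

theorem finite_symb {d : ℕ} (H : SimpleGraph (Fin d ⊕ Fin d)) (i : ℕ) : Finite (Symb H i) :=
  Finite.of_injective (fun p : Symb H i => (p.C, p.σ)) fun p q h => by
    simp only [Prod.mk.injEq] at h
    exact Symb.ext h.1 h.2

/-- The inclusion of `F_i` into the free module on all pairs of finite sets. -/
def symbChain (R : Type*) [CommRing R] {d : ℕ} (H : SimpleGraph (Fin d ⊕ Fin d)) (i : ℕ) :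
    (Symb H i →₀ R) →ₗ[R] (Cell d →₀ R) :=
  Finsupp.lmapDomain R R Symb.toCell

theorem symbChain_single (R : Type*) [CommRing R] {d : ℕ} {H : SimpleGraph (Fin d ⊕ Fin d)}
    {i : ℕ} (p : Symb H i) (r : R) :
    symbChain R H i (Finsupp.single p r) = Finsupp.single p.toCell r := by
  simp [symbChain]

theorem symbChain_injective (R : Type*) [CommRing R] {d : ℕ} {H : SimpleGraph (Fin d ⊕ Fin d)}
    (hH : IsVeryWellCovered H) (hl : IsStandardLabelled H) (i : ℕ) :
    Function.Injective (symbChain R H i) :=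
  Finsupp.mapDomain_injective (Symb.toCell_injective hH hl i)

theorem symbChain_differential (k : Type*) [Field k] {d : ℕ} {H : SimpleGraph (Fin d ⊕ Fin d)}
    (hH : IsVeryWellCovered H) (hl : IsStandardLabelled H) {n : Fin d → ℕ} {V : Type*}
    (e : BlowUpVertex n ≃ V) (i : ℕ) (z : Symb H (i + 1) →₀ MvPolynomial V k) :
    symbChain _ H i (differential k hH hl e i z) = cellDiff k e (symbChain _ H (i + 1) z) := by
  suffices h : symbChain (MvPolynomial V k) H i ∘ₗ differential k hH hl e i =
      cellDiff k e ∘ₗ symbChain _ H (i + 1) from LinearMap.congr_fun h z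
  refine Finsupp.lhom_ext' fun p => LinearMap.ext_ring ?_
  simp only [LinearMap.comp_apply, Finsupp.lsingle_apply, symbChain_single]
  rw [differential, Finsupp.linearCombination_single, one_smul, map_sum, Symb.toCell, cellDiff,
    cubeDiff_single, one_smul]
  refine Eq.trans (Finset.sum_congr rfl fun s _ => ?_) (Finset.sum_attach p.σ _)
  rw [map_smul, map_sub, symbChain_single, symbChain_single, Symb.toCell_swap]
  rfl

theorem augmentation_eq_cellAug (k : Type*) [Field k] {d : ℕ} {H : SimpleGraph (Fin d ⊕ Fin d)}
    (hH : IsVeryWellCovered H) (hl : IsStandardLabelled H) {n : Fin d → ℕ} {V : Type*}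
    (e : BlowUpVertex n ≃ V) (z : Symb H 0 →₀ MvPolynomial V k) :
    augmentation k H e z = cellAug k e (symbChain _ H 0 z) := by
  suffices h : augmentation k H e = cellAug k e ∘ₗ symbChain _ H 0 from LinearMap.congr_fun h z
  refine Finsupp.lhom_ext' fun p => LinearMap.ext_ring ?_
  simp only [LinearMap.comp_apply, Finsupp.lsingle_apply, symbChain_single]
  have hσ : p.σ = ∅ := Finset.card_eq_zero.1 p.card_eq
  rw [augmentation, cellAug, Finsupp.linearCombination_single, Finsupp.linearCombination_single,
    one_smul, one_smul, Symb.toCell, if_pos hσ, cellExp, monomial_sum_one, hσ, Finset.sdiff_empty]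
  change _ = ∏ v ∈ coverOf (yIndices p.C), monomial (primedExp e v) (1 : k)
  rw [coverOf_yIndices hH hl p.isMin]
  exact Finset.prod_congr rfl fun v _ => primed_eq_monomial k e v

theorem cellAug_symbChain_succ (k : Type*) [Field k] {d : ℕ} (H : SimpleGraph (Fin d ⊕ Fin d))
    {n : Fin d → ℕ} {V : Type*} (e : BlowUpVertex n ≃ V) (i : ℕ)
    (z : Symb H (i + 1) →₀ MvPolynomial V k) :
    cellAug k e (symbChain _ H (i + 1) z) = 0 := by
  suffices h : cellAug k e ∘ₗ symbChain _ H (i + 1) = 0 from LinearMap.congr_fun h z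
  refine Finsupp.lhom_ext' fun p => LinearMap.ext_ring ?_
  simp only [LinearMap.comp_apply, Finsupp.lsingle_apply, symbChain_single, LinearMap.zero_apply]
  have hσ : p.σ ≠ ∅ := by
    rw [Finset.nonempty_iff_ne_empty.symm, ← Finset.card_pos, p.card_eq]
    exact Nat.succ_pos i
  rw [cellAug, Finsupp.linearCombination_single, Symb.toCell, if_neg hσ, smul_zero]

theorem linearMap_ext_monomial {k V B N : Type*} [Field k] [AddCommGroup N] [Module k N]
    {f g : (B →₀ MvPolynomial V k) →ₗ[k] N}
    (h : ∀ p u, f (Finsupp.single p (monomial u 1)) = g (Finsupp.single p (monomial u 1))) :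
    f = g := by
  refine Finsupp.lhom_ext' fun p => (basisMonomials V k).ext fun u => ?_
  simpa using h p u

theorem cellDiff_cellHomotopy_add_symbChain (k : Type*) [Field k] {d : ℕ}
    {H : SimpleGraph (Fin d ⊕ Fin d)} (hH : IsVeryWellCovered H) (hl : IsStandardLabelled H)
    {n : Fin d → ℕ} {V : Type*} (e : BlowUpVertex n ≃ V) {i : ℕ}
    (z : Symb H i →₀ MvPolynomial V k) :
    cellDiff k e (cellHomotopy k H e (symbChain _ H i z)) +
        cellHomotopy k H e (cellDiff k e (symbChain _ H i z)) +
        cellSection k H e (cellAug k e (symbChain _ H i z)) = symbChain _ H i z := by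
  let ι := (symbChain (MvPolynomial V k) H i).restrictScalars k
  let D := (cellDiff k e).restrictScalars k
  suffices h : D ∘ₗ cellHomotopy k H e ∘ₗ ι + cellHomotopy k H e ∘ₗ D ∘ₗ ι +
      cellSection k H e ∘ₗ (cellAug k e).restrictScalars k ∘ₗ ι = ι from LinearMap.congr_fun h z
  refine linearMap_ext_monomial fun p u => ?_
  simp only [LinearMap.add_apply, LinearMap.comp_apply, LinearMap.restrictScalars_apply,
    symbChain_single, ι, D]
  exact cellDiff_cellHomotopy_add k hH hl e (p.isCoverCell hH hl) u

/-- Allows the homotopy, defined on all cells, to be read as a map from `F_i` to `F_{i+1}`. -/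
theorem cellHomotopy_symbChain_mem (k : Type*) [Field k] {d : ℕ}
    {H : SimpleGraph (Fin d ⊕ Fin d)} (hH : IsVeryWellCovered H) (hl : IsStandardLabelled H)
    {n : Fin d → ℕ} {V : Type*} (e : BlowUpVertex n ≃ V) {i : ℕ}
    (z : Symb H i →₀ MvPolynomial V k) :
    cellHomotopy k H e (symbChain _ H i z) ∈
      LinearMap.range (symbChain (MvPolynomial V k) H (i + 1)) := by
  -- Membership is rephrased as vanishing of a `k`-linear map into the quotient, which can be tested
  -- on monomial multiples of basis elements.
  let Q := (LinearMap.range (symbChain (MvPolynomial V k) H (i + 1))).restrictScalars k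
  suffices h : Q.mkQ ∘ₗ cellHomotopy k H e ∘ₗ (symbChain _ H i).restrictScalars k = 0 from
    (Submodule.Quotient.mk_eq_zero Q).1 (LinearMap.congr_fun h z)
  refine linearMap_ext_monomial fun p u => ?_
  simp only [LinearMap.comp_apply, LinearMap.restrictScalars_apply, symbChain_single,
    LinearMap.zero_apply, cellHomotopy_single]
  refine (Submodule.Quotient.mk_eq_zero Q).2 ?_
  set a := u + cellExp e p.toCell
  have hp : IsStrandCell H (yDivisors e a) (xDivisors e a) p.toCell :=
    (isStrandCell_iff e).2 ⟨p.isCoverCell hH hl, le_add_self⟩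
  have hmem := IsStrandCell.contract_mem hH hl k hp
  rw [Finsupp.supported_eq_span_single] at hmem
  refine (Submodule.span_le (p := Q.comap (strand k e a))).2 ?_ hmem
  rintro _ ⟨q, ⟨hq, hcard⟩, rfl⟩
  obtain ⟨p', hp'⟩ := hq.toIsCoverCell.exists_symb (hcard.trans (congrArg (· + 1) p.card_eq))
  rw [SetLike.mem_coe, Submodule.mem_comap, strand_single, ← hp', ← symbChain_single]
  exact ⟨_, rfl⟩

/-- For such `z` the homotopy identity reduces to its first term, so the homotopy applied to `z` is
a preimage. -/
theorem exists_differential_eq (k : Type*) [Field k] {d : ℕ}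
    {H : SimpleGraph (Fin d ⊕ Fin d)} (hH : IsVeryWellCovered H) (hl : IsStandardLabelled H)
    {n : Fin d → ℕ} {V : Type*} (e : BlowUpVertex n ≃ V) {i : ℕ}
    {z : Symb H i →₀ MvPolynomial V k} (h1 : cellDiff k e (symbChain _ H i z) = 0)
    (h2 : cellAug k e (symbChain _ H i z) = 0) : ∃ w, differential k hH hl e i w = z := by
  obtain ⟨w, hw⟩ := cellHomotopy_symbChain_mem k hH hl e z
  refine ⟨w, symbChain_injective _ hH hl i ?_⟩
  have := cellDiff_cellHomotopy_add_symbChain k hH hl e z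
  rwa [h1, h2, map_zero, map_zero, add_zero, add_zero, ← hw, ← symbChain_differential] at this

theorem exact_differential (k : Type*) [Field k] {d : ℕ}
    {H : SimpleGraph (Fin d ⊕ Fin d)} (hH : IsVeryWellCovered H) (hl : IsStandardLabelled H)
    {n : Fin d → ℕ} {V : Type*} (e : BlowUpVertex n ≃ V) (i : ℕ) :
    Function.Exact (differential k hH hl e (i + 1)) (differential k hH hl e i) := by
  intro z
  constructor
  · intro hz
    refine exists_differential_eq k hH hl e ?_ (cellAug_symbChain_succ k H e i z)
    rw [← symbChain_differential k hH hl e i z, hz, map_zero]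
  · rintro ⟨w, rfl⟩
    apply symbChain_injective _ hH hl i
    rw [symbChain_differential, symbChain_differential, cellDiff, cubeDiff_cubeDiff, map_zero]

theorem exact_augmentation (k : Type*) [Field k] {d : ℕ}
    {H : SimpleGraph (Fin d ⊕ Fin d)} (hH : IsVeryWellCovered H) (hl : IsStandardLabelled H)
    {n : Fin d → ℕ} {V : Type*} (e : BlowUpVertex n ≃ V) :
    Function.Exact (differential k hH hl e 0) (augmentation k H e) := by
  intro z
  constructor
  · intro hz
    refine exists_differential_eq k hH hl e ?_ ((augmentation_eq_cellAug k hH hl e z).symm.trans hz)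
    suffices h : cellDiff k e ∘ₗ symbChain _ H 0 = 0 from LinearMap.congr_fun h z
    refine Finsupp.lhom_ext' fun p => LinearMap.ext_ring ?_
    simp only [LinearMap.comp_apply, Finsupp.lsingle_apply, symbChain_single,
      LinearMap.zero_apply]
    rw [Symb.toCell, Finset.card_eq_zero.1 p.card_eq, cellDiff, cubeDiff_single, Finset.sum_empty,
      smul_zero]
  · rintro ⟨w, rfl⟩
    rw [augmentation_eq_cellAug k hH hl, symbChain_differential]
    suffices h : cellAug k e ∘ₗ cellDiff k e ∘ₗ symbChain _ H 1 = 0 from LinearMap.congr_fun h w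
    refine Finsupp.lhom_ext' fun p => LinearMap.ext_ring ?_
    simp only [LinearMap.comp_apply, Finsupp.lsingle_apply, symbChain_single,
      LinearMap.zero_apply]
    exact cellAug_cellDiff k e (p.isCoverCell hH hl).subset 1

/-! ### The cover ideal of the blow-up -/

theorem isVertexCover_blowUp {d : ℕ} {H : SimpleGraph (Fin d ⊕ Fin d)} {n : Fin d → ℕ}
    {V : Type*} [DecidableEq V] {G : SimpleGraph V} (e : blowUp H n ≃g G)
    {C : Finset (Fin d ⊕ Fin d)} (hC : H.IsVertexCover (C : Set (Fin d ⊕ Fin d))) :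
    G.IsVertexCover
      ((C.sigma fun _ => Finset.univ).map e.toEquiv.toEmbedding : Finset V) := by
  intro u v huv
  obtain ⟨p, rfl⟩ := e.surjective u
  obtain ⟨q, rfl⟩ := e.surjective v
  have h := hC (e.map_adj_iff.1 huv : H.Adj p.1 q.1)
  simpa using h

theorem prod_primed_eq (k : Type*) [Field k] {d : ℕ} {n : Fin d → ℕ} {V : Type*}
    (e : BlowUpVertex n ≃ V) (C : Finset (Fin d ⊕ Fin d)) :
    ∏ v ∈ C, primed k e v =
      ∏ w ∈ (C.sigma fun _ => Finset.univ).map e.toEmbedding, X w := by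
  rw [Finset.prod_map, Finset.prod_sigma]
  rfl

theorem exists_isMinVertexCover_of_blowUp {d : ℕ} {H : SimpleGraph (Fin d ⊕ Fin d)}
    {n : Fin d → ℕ} {V : Type*} {G : SimpleGraph V} (e : blowUp H n ≃g G) {D : Finset V}
    (hD : G.IsVertexCover (D : Set V)) :
    ∃ C, IsMinVertexCover H C ∧ (C.sigma fun _ => Finset.univ).map e.toEquiv.toEmbedding ⊆ D := by
  classical
  -- The vertices all of whose copies lie in `D`. If an edge of `H` had a missing copy at each end,
  -- those two copies would span an edge that `D` misses.
  let C' : Finset (Fin d ⊕ Fin d) :=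
    Finset.univ.filter fun v => ∀ j : Fin (n (idx v)), e ⟨v, j⟩ ∈ D
  have hC' : H.IsVertexCover (C' : Set (Fin d ⊕ Fin d)) := by
    intro u v huv
    by_contra hcon
    simp only [C', Finset.coe_filter, Finset.mem_univ, true_and, Set.mem_ofPred_eq, not_or,
      not_forall] at hcon
    obtain ⟨⟨i, hi⟩, j, hj⟩ := hcon
    have : G.Adj (e ⟨u, i⟩) (e ⟨v, j⟩) := e.map_adj_iff.2 huv
    rcases hD this with h | h
    · exact hi h
    · exact hj h
  obtain ⟨C, hCC', hC⟩ := exists_minimal_le_of_wellFoundedLT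
    (fun D : Finset (Fin d ⊕ Fin d) => H.IsVertexCover (D : Set (Fin d ⊕ Fin d))) C' hC'
  refine ⟨C, hC, fun w hw => ?_⟩
  obtain ⟨⟨v, j⟩, hv, rfl⟩ := Finset.mem_map.1 hw
  exact (Finset.mem_filter.1 (hCC' (Finset.mem_sigma.1 hv).1)).2 j

theorem range_augmentation (k : Type*) [Field k] {d : ℕ} (H : SimpleGraph (Fin d ⊕ Fin d))
    {n : Fin d → ℕ} {V : Type*} [DecidableEq V] (G : SimpleGraph V) (e : blowUp H n ≃g G) :
    LinearMap.range (augmentation k H e.toEquiv) = coverIdeal k G := by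
  rw [augmentation, Finsupp.range_linearCombination, coverIdeal]
  refine le_antisymm (Submodule.span_le.2 ?_) (Submodule.span_le.2 ?_)
  · rintro _ ⟨p, rfl⟩
    exact Submodule.subset_span ⟨_, isVertexCover_blowUp e p.isMin.prop, prod_primed_eq k _ _⟩
  · rintro _ ⟨D, hD, rfl⟩
    obtain ⟨C, hC, hCD⟩ := exists_isMinVertexCover_of_blowUp e hD
    have hz : ∏ v ∈ C, primed k e.toEquiv v ∈ Ideal.span (Set.range fun p : Symb H 0 =>
        ∏ v ∈ p.C, primed k e.toEquiv v) :=
      Submodule.subset_span ⟨⟨C, ∅, hC, Finset.empty_subset _, rfl⟩, rfl⟩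
    refine Ideal.mem_of_dvd _ ?_ hz
    rw [prod_primed_eq]
    exact Finset.prod_dvd_prod_of_subset _ _ _ hCD

/-! ### Minimality and homogeneity -/

/-- Positivity of the `n i` enters here: an empty product would be the unit 1, and the complex would
not be minimal. -/
theorem primed_mem (k : Type*) [Field k] {d : ℕ} {n : Fin d → ℕ} (hn : ∀ i, 0 < n i) {V : Type*}
    (e : BlowUpVertex n ≃ V) (v : Fin d ⊕ Fin d) :
    primed k e v ∈ Ideal.span (Set.range (X : V → MvPolynomial V k)) :=
  Ideal.mem_of_dvd _ (Finset.dvd_prod_of_mem (fun j => X (e ⟨v, j⟩))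
    (Finset.mem_univ (⟨0, hn _⟩ : Fin (n (idx v))))) (Ideal.subset_span ⟨_, rfl⟩)

theorem single_mem_smul_top {R B : Type*} [CommRing R] {I : Ideal R} {r : R} (hr : r ∈ I) (b : B) :
    Finsupp.single b r ∈ I • (⊤ : Submodule R (B →₀ R)) := by
  have := Submodule.smul_mem_smul hr
    (Submodule.mem_top : Finsupp.single b 1 ∈ (⊤ : Submodule R (B →₀ R)))
  simpa using this

theorem range_differential_le (k : Type*) [Field k] {d : ℕ}
    {H : SimpleGraph (Fin d ⊕ Fin d)} (hH : IsVeryWellCovered H) (hl : IsStandardLabelled H)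
    {n : Fin d → ℕ} (hn : ∀ i, 0 < n i) {V : Type*} (e : BlowUpVertex n ≃ V) (i : ℕ) :
    LinearMap.range (differential k hH hl e i) ≤
      Ideal.span (Set.range (X : V → MvPolynomial V k)) •
        (⊤ : Submodule (MvPolynomial V k) (Symb H i →₀ MvPolynomial V k)) := by
  rw [differential, Finsupp.range_linearCombination]
  refine Submodule.span_le.2 ?_
  rintro _ ⟨p, rfl⟩
  exact Submodule.sum_mem _ fun s _ => Submodule.smul_mem _ _ (Submodule.sub_mem _
    (single_mem_smul_top (primed_mem k hn e _) _) (single_mem_smul_top (primed_mem k hn e _) _))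

theorem isMinimalFreeResolution (k : Type*) [Field k] {d : ℕ} {H : SimpleGraph (Fin d ⊕ Fin d)}
    (hH : IsVeryWellCovered H) (hl : IsStandardLabelled H) {n : Fin d → ℕ} (hn : ∀ i, 0 < n i)
    {V : Type*} [DecidableEq V] (G : SimpleGraph V) (e : blowUp H n ≃g G) :
    IsMinimalFreeResolution (coverIdeal k G) (Symb H) (differential k hH hl e.toEquiv)
      (augmentation k H e.toEquiv) where
  finite := finite_symb H
  range_augmentation := range_augmentation k H G e
  exact_zero := exact_augmentation k hH hl e.toEquiv
  exact_succ := exact_differential k hH hl e.toEquiv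
  minimal := range_differential_le k hH hl hn e.toEquiv

theorem symbDegree_drop {M : Type*} [AddCommGroup M] {d : ℕ} {H : SimpleGraph (Fin d ⊕ Fin d)}
    (D : Fin d ⊕ Fin d → M) {i : ℕ} (p : Symb H (i + 1)) (s : Fin d) (hs : s ∈ p.σ) :
    symbDegree D (i + 1) p - symbDegree D i (p.drop s hs) = D (Sum.inl s) := by
  simp only [symbDegree, Symb.drop]
  rw [← Finset.sum_erase_add _ _ hs]
  abel

/-- The degree of `x'_s` moves from `σ` to the cover, so the net loss is that of `y'_s`. This needs
`x_s ∉ C`, which holds because `C` contains only one end of each matching edge. -/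
theorem symbDegree_swap {M : Type*} [AddCommGroup M] {d : ℕ} {H : SimpleGraph (Fin d ⊕ Fin d)}
    (hH : IsVeryWellCovered H) (hl : IsStandardLabelled H)
    (D : Fin d ⊕ Fin d → M) {i : ℕ} (p : Symb H (i + 1)) (s : Fin d) (hs : s ∈ p.σ) :
    symbDegree D (i + 1) p - symbDegree D i (p.swap hH hl s hs) = D (Sum.inr s) := by
  have hy : Sum.inr s ∈ p.C := (mem_swapSet.1 (p.subset hs)).1
  have hx : Sum.inl s ∉ p.C := by
    rw [← coverOf_yIndices hH hl p.isMin]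
    simpa [yIndices] using hy
  simp only [symbDegree, Symb.swap]
  rw [Finset.sum_insert fun h => hx (Finset.mem_of_mem_erase h), ← Finset.sum_erase_add _ _ hs,
    ← Finset.sum_erase_add _ _ hy]
  abel

/-- Handles all three gradings at once: only the degrees of `x'_i` and `y'_i` matter. -/
theorem isHomogeneousComplex_of_primed {k : Type*} [Field k] {d : ℕ}
    {H : SimpleGraph (Fin d ⊕ Fin d)} (hH : IsVeryWellCovered H) (hl : IsStandardLabelled H)
    {n : Fin d → ℕ} {V : Type*} (e : BlowUpVertex n ≃ V) {M : Type*} [AddCommGroup M]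
    (w : V → M) (D : Fin d ⊕ Fin d → M)
    (hD : ∀ v, ∑ j : Fin (n (idx v)), w (e ⟨v, j⟩) = D v) :
    IsHomogeneousComplex w (Symb H) (symbDegree D) (differential k hH hl e)
      (augmentation k H e) := by
  have hprimed : ∀ v, IsWeightedHomogeneous w (primed k e v) (D v) := fun v =>
    hD v ▸ IsWeightedHomogeneous.prod _ _ _ fun j _ => isWeightedHomogeneous_X k w _
  refine ⟨fun p => ?_, fun i p c => ?_⟩
  · rw [augmentation, Finsupp.linearCombination_single, one_smul, symbDegree,
      Finset.card_eq_zero.1 p.card_eq, Finset.sum_empty, add_zero]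
    exact IsWeightedHomogeneous.prod _ _ _ fun v _ => hprimed v
  · classical
    rw [differential, Finsupp.linearCombination_single, one_smul, Finsupp.finsetSum_apply,
      ← mem_weightedHomogeneousSubmodule]
    refine Submodule.sum_mem _ fun s _ => ?_
    have hsingle : ∀ (q : Symb H i) (v : Fin d ⊕ Fin d),
        symbDegree D (i + 1) p - symbDegree D i q = D v →
        Finsupp.single q (primed k e v) c ∈
          weightedHomogeneousSubmodule k w (symbDegree D (i + 1) p - symbDegree D i c) := by
      intro q v hq
      rw [Finsupp.single_apply]
      split_ifs with h
      · rw [← h, hq]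
        exact hprimed v
      · exact Submodule.zero_mem _
    have hsub := Submodule.sub_mem _ (hsingle _ _ (symbDegree_swap hH hl D p s.1 s.2))
      (hsingle _ _ (symbDegree_drop D p s.1 s.2))
    rw [Finsupp.smul_apply, Finsupp.sub_apply, smul_eq_mul]
    rcases neg_one_pow_eq_or (MvPolynomial V k) (alpha p.σ s.1) with h | h <;> rw [h]
    · rwa [one_mul]
    · rw [neg_one_mul]
      exact Submodule.neg_mem _ hsub

theorem sum_blockDegree {d : ℕ} {n : Fin d → ℕ} {V : Type*} (e : BlowUpVertex n ≃ V)
    (v : Fin d ⊕ Fin d) :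
    ∑ j : Fin (n (idx v)), blockDegree e (e ⟨v, j⟩) = blockDegreePrimed n v := by
  have h : ∀ j, blockDegree e (e ⟨v, j⟩) =
      (Pi.single ⟨idx v, j⟩ 1 : (Σ i : Fin d, Fin (n i)) → ℤ) := fun j =>
    congrArg (fun p : BlowUpVertex n =>
      (Pi.single ⟨idx p.1, p.2⟩ 1 : (Σ i : Fin d, Fin (n i)) → ℤ)) (e.symm_apply_apply ⟨v, j⟩)
  funext q
  obtain ⟨i, l⟩ := q
  rw [Finset.sum_apply, Finset.sum_congr rfl fun j _ => congrFun (h j) _, blockDegreePrimed]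
  split_ifs with hi
  · obtain rfl : i = idx v := hi
    simp [Pi.single_apply]
  · refine Finset.sum_eq_zero fun j _ => ?_
    rw [Pi.single_apply, if_neg]
    exact fun h' => hi (congrArg Sigma.fst h')

end

end CoverResolution

theorem mainTheorem3 {k : Type*} [Field k] {d : ℕ} (H : SimpleGraph (Fin d ⊕ Fin d))
    (hCM : CoverResolution.IsCohenMacaulayGraph k H)
    (hH : CoverResolution.IsVeryWellCovered H)
    (hl : CoverResolution.IsStandardLabelled H)
    (n : Fin d → ℕ) (hn : ∀ i, 0 < n i)
    {V : Type*} [Fintype V] [DecidableEq V] (G : SimpleGraph V)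
    (e : CoverResolution.blowUp H n ≃g G) :
    CoverResolution.IsMinimalFreeResolution (CoverResolution.coverIdeal k G)
        (CoverResolution.Symb H)
        (CoverResolution.differential k hH hl e.toEquiv)
        (CoverResolution.augmentation k H e.toEquiv) ∧
      CoverResolution.IsHomogeneousComplex CoverResolution.fineDegree
        (CoverResolution.Symb H)
        (CoverResolution.symbDegree (CoverResolution.fineDegreePrimed e.toEquiv))
        (CoverResolution.differential k hH hl e.toEquiv)
        (CoverResolution.augmentation k H e.toEquiv) ∧
      CoverResolution.IsHomogeneousComplex (CoverResolution.blockDegree e.toEquiv)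
        (CoverResolution.Symb H)
        (CoverResolution.symbDegree (CoverResolution.blockDegreePrimed n))
        (CoverResolution.differential k hH hl e.toEquiv)
        (CoverResolution.augmentation k H e.toEquiv) ∧
      CoverResolution.IsHomogeneousComplex (fun _ : V => (1 : ℤ))
        (CoverResolution.Symb H)
        (CoverResolution.symbDegree (CoverResolution.totalDegreePrimed n))
        (CoverResolution.differential k hH hl e.toEquiv)
        (CoverResolution.augmentation k H e.toEquiv) := by
  refine ⟨CoverResolution.isMinimalFreeResolution k hH hl hn G e,
    CoverResolution.isHomogeneousComplex_of_primed hH hl _ _ _ fun v => rfl,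
    CoverResolution.isHomogeneousComplex_of_primed hH hl _ _ _
      (CoverResolution.sum_blockDegree e.toEquiv),
    CoverResolution.isHomogeneousComplex_of_primed hH hl _ _ _ fun v => ?_⟩
  simp [CoverResolution.totalDegreePrimed]
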